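/- Let $S$ be a separable metric space with its Borel $\sigma$-algebra, let $m\ge 2$, and let $h:S^m\to\mathbb R$ be a measurable symmetric function. Let $(Z_i)_{i\ge1}$ be an iid sequence of $S$-valued random elements with common law $F\in\Gamma_{2,h}$, where $\Gamma_{2,h}$ is the set of probability measures $H$ on $S$ such that $\mathbb E[h(Y_1,\dots,Y_m)^2]<\infty$ for iid $Y_1,\dots,Y_m$ with law $H$. Assume moreover that $$\mathbb E\big[|h(Z_{i_1},\dots,Z_{i_m})|^2\big]<\infty\qquad\text{for all indices } 1\le i_1\le\dots\le i_m\le m .$$ For $H\in\Gamma_{2,h}$ put $$h_2(x,y;H)=\mathbb E[h(x,y,Y_3,\dots,Y_m)]-\mathbb E[h(x,Y_2,\dots,Y_m)]-\mathbb E[h(Y_1,y,Y_3,\dots,Y_m)]+\mathbb E[h(Y_1,\dots,Y_m)],\qquad x,y\in S,$$ where $(Y_i)$ are iid with law $H$ (for $H=F$ this is defined for $F\times F$-almost every $(x,y)$). For $n\ge1$ let $F_n=\frac1n\sum_{i=1}^n\delta_{Z_i}$ be the empirical law of $Z_1,\dots,Z_n$, and, given the realization of $(Z_i)$, let $Z^*_{n1},\dots,Z^*_{nn}$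 be iid with law $F_n$. For probability measures $\mu,\nu$ on $\mathbb R$ let $$d_2(\mu,\nu)=\inf\big\{(\mathbb E|A-B|^2)^{1/2}:\ \mathcal L(A)=\mu,\ \mathcal L(B)=\nu\big\}.$$ Then, for almost all realizations of $(Z_i)$, $$d_2\Big(\mathcal L\Big(\frac1n\sum_{1\le i\ne j\le n}h_2(Z^*_{ni},Z^*_{nj};F_n)\Big),\ \mathcal L\Big(\frac1n\sum_{1\le i\ne j\le n}h_2(Z_i,Z_j;F)\Big)\Big)\longrightarrow0\qquad(n\to\infty),$$ where the first law is the conditional one, given the realization of $(Z_i)$. -/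

import Mathlib

open MeasureTheory ProbabilityTheory Filter Topology
open scoped ENNReal

noncomputable section

namespace BootstrapU

/-- A kernel of `m` variables is symmetric if it is invariant under permutations of them. -/
def IsSymmetricKernel {S : Type*} {m : ℕ} (h : (Fin m → S) → ℝ) : Prop :=
  ∀ (σ : Equiv.Perm (Fin m)) (x : Fin m → S), h (x ∘ σ) = h x

/-- The class `Γ_{2,h}` of the probability laws `H` on `S` such that
`E[h(Z_1, …, Z_m)^2] < ∞` for iid `Z_1, …, Z_m` with common law `H`. -/
def Gamma2h {S : Type*} [MeasurableSpace S] {m : ℕ} (h : (Fin m → S) → ℝ) : Set (Measure S) :=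
  {H | IsProbabilityMeasure H ∧ MemLp h 2 (Measure.pi fun _ : Fin m => H)}

/-- The tuple `z` with its first entry replaced by `x`. -/
def setFst {S : Type*} {m : ℕ} (x : S) (z : Fin m → S) : Fin m → S :=
  fun i => if i.val = 0 then x else z i

/-- The tuple `z` with its second entry replaced by `y`. -/
def setSnd {S : Type*} {m : ℕ} (y : S) (z : Fin m → S) : Fin m → S :=
  fun i => if i.val = 1 then y else z i

/-- The degenerate kernel
`h₂(x, y; H) = E h(x, y, Z_3, …, Z_m) - E h(x, Z_2, …, Z_m) - E h(Z_1, y, Z_3, …, Z_m)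
  + E h(Z_1, …, Z_m)`, where `Z_1, …, Z_m` are iid with law `H` and `m ≥ 2`. -/
def h2 {S : Type*} [MeasurableSpace S] {m : ℕ} (h : (Fin m → S) → ℝ) (H : Measure S)
    (x y : S) : ℝ :=
  (∫ z, h (setFst x (setSnd y z)) ∂(Measure.pi fun _ : Fin m => H))
    - (∫ z, h (setFst x z) ∂(Measure.pi fun _ : Fin m => H))
    - (∫ z, h (setSnd y z) ∂(Measure.pi fun _ : Fin m => H))
    + ∫ z, h z ∂(Measure.pi fun _ : Fin m => H)

/-- The normalized statistic `(1/n) ∑_{1 ≤ i ≠ j ≤ n} h₂(x_i, x_j; H)`, the sum being over all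
ordered pairs of distinct indices. -/
def uStat {S : Type*} [MeasurableSpace S] {m : ℕ} (h : (Fin m → S) → ℝ) (H : Measure S)
    (n : ℕ) (x : Fin n → S) : ℝ :=
  (1 / (n : ℝ)) * ∑ p ∈ (Finset.univ : Finset (Fin n)).offDiag, h2 h H (x p.1) (x p.2)

/-- The empirical law of `z_1, …, z_n` (for `n ≥ 1`). -/
def empiricalLaw {S : Type*} [MeasurableSpace S] (n : ℕ) (z : Fin n → S) : Measure S :=
  (n : ℝ≥0∞)⁻¹ • ∑ i : Fin n, Measure.dirac (z i)

/-- The Wasserstein (Mallows) metric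
`d₂(F, G) = inf {(E|A - B|²)^{1/2} : A has law F, B has law G}` for laws on the line, the infimum
being over the joint laws `π` of the pairs `(A, B)`, with values in `[0, ∞]`. -/
def d2 (F G : Measure ℝ) : ℝ≥0∞ :=
  ⨅ (π : Measure (ℝ × ℝ))
    (_ : IsProbabilityMeasure π ∧ π.map Prod.fst = F ∧ π.map Prod.snd = G),
    (∫⁻ p, ENNReal.ofReal (|p.1 - p.2| ^ 2) ∂π) ^ (1 / 2 : ℝ)

end BootstrapU

end

/-! The heart of the matter is a bound uniform in `n`. Let `π` couple two laws `G` and `F`. The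
difference of the two statistics, evaluated at the components of an iid sample from `π`, is almost
surely again such a statistic, built from the kernel `diffKernel h` under `π`. Its kernel `h2` is
degenerate, so products over different unordered pairs of indices are orthogonal; about `n ^ 2`
terms survive and the factor `1 / n` cancels them (`lintegral_uStat_sq_le`). Hence `d2_uStat_le`:
the squared distance is at most 32 times the mean of `|h(X) - h(Y)|²`, the pairs `(X_k, Y_k)` being
iid with law `π`.

It remains to couple the empirical law with `F` so that this mean is small. Approximate `h` in `L²`
by a function `g` of finitely many labels (`exists_isBlockFun_eLpNorm_le`), and couple so that
labels disagree with the least probability (`exists_block_coupling`). By the strong law for the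
finitely many block frequencies, that probability tends to zero. Besides the cost of disagreement,
one pays for `(h - g)²` integrated against the powers of `F` and of the empirical law.

The last integral is a V-statistic. By `vMean_le` it is at most a U-statistic plus a term of order
`1 / n` made of U-statistics of contracted kernels; the moment condition on repeated indices makes
these integrable. U-statistics form a reverse martingale, and Doob's inequality (`maximal_uMean`)
bounds them almost surely and keeps the main one below `ε` except with probability at most the mean
of `(h - g)²` divided by `ε`. Since `g` is arbitrary, this probability can be made as small as
desired (`ae_eventually_d2_le`); no convergence theorem for U-statistics is needed. -/

namespace BootstrapU

/-! ### Marginals and resampling in finite product measures. -/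

section ProductMeasures

variable {T : Type*} [MeasurableSpace T] (μ : Measure T) [IsProbabilityMeasure μ]

lemma measurePreserving_eval_pair {ι : Type*} [Fintype ι] {a b : ι} (hab : a ≠ b) :
    MeasurePreserving (fun w : ι → T => (w a, w b)) (Measure.pi fun _ => μ) (μ.prod μ) := by
  refine ⟨by fun_prop, ?_⟩
  rw [← Measure.infinitePi_eq_pi]
  exact Measure.infinitePi_map_eval_prod hab

/-- Resampling one coordinate of an iid family. -/
lemma measurePreserving_resample {ι : Type*} [Fintype ι] [DecidableEq ι] (a : ι) :
    MeasurePreserving (fun p : T × (ι → T) => Function.update p.2 a p.1)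
      (μ.prod (Measure.pi fun _ => μ)) (Measure.pi fun _ => μ) := by
  have hmeas : Measurable (fun p : T × (ι → T) => Function.update p.2 a p.1) := by
    refine measurable_pi_iff.2 fun i => ?_
    by_cases hi : i = a
    · subst hi; simpa using measurable_fst
    · simp only [Function.update_of_ne hi]
      fun_prop
  refine ⟨hmeas, (Measure.pi_eq fun s hs => ?_).symm⟩
  have hpre : (fun p : T × (ι → T) => Function.update p.2 a p.1) ⁻¹' Set.univ.pi s
      = s a ×ˢ Set.univ.pi (Function.update s a Set.univ) := by
    ext p
    simp only [Set.mem_preimage, Set.mem_pi, Set.mem_univ, true_imp_iff, Set.mem_prod]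
    constructor
    · intro hp
      refine ⟨by simpa using hp a, fun i => ?_⟩
      by_cases hi : i = a
      · subst hi; simp
      · simpa [Function.update_of_ne hi] using hp i
    · rintro ⟨h1, h2⟩ i
      by_cases hi : i = a
      · subst hi; simpa using h1
      · simpa [Function.update_of_ne hi] using h2 i
  rw [Measure.map_apply hmeas (MeasurableSet.univ_pi hs), hpre, Measure.prod_prod, Measure.pi_pi,
    ← Finset.mul_prod_erase _ _ (Finset.mem_univ a), ← Finset.mul_prod_erase Finset.univ
      (fun i => μ (s i)) (Finset.mem_univ a)]
  simp only [Function.update_self, measure_univ, one_mul]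
  congr 1
  refine Finset.prod_congr rfl fun i hi => ?_
  rw [Function.update_of_ne (Finset.ne_of_mem_erase hi)]

end ProductMeasures

/-! ### Replacing the first two entries of an iid tuple. -/

section Tuples

variable {S : Type*} {m : ℕ}

lemma setFst_eq_update (hm : 2 ≤ m) (x : S) (z : Fin m → S) :
    setFst x z = Function.update z ⟨0, by omega⟩ x := by
  ext i
  simp [setFst, Function.update_apply, Fin.ext_iff]

lemma setSnd_eq_update (hm : 2 ≤ m) (y : S) (z : Fin m → S) :
    setSnd y z = Function.update z ⟨1, by omega⟩ y := by
  ext i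
  simp [setSnd, Function.update_apply, Fin.ext_iff]

lemma setFst_setSnd_comm (x y : S) (z : Fin m → S) :
    setFst x (setSnd y z) = setSnd y (setFst x z) := by
  ext i
  simp only [setFst, setSnd]
  split_ifs <;> first | rfl | omega

lemma comp_setFst {S' : Type*} (g : S → S') (x : S) (z : Fin m → S) :
    (fun k => g (setFst x z k)) = setFst (g x) (fun k => g (z k)) := by
  ext i; simp only [setFst]; split_ifs <;> rfl

lemma comp_setSnd {S' : Type*} (g : S → S') (x : S) (z : Fin m → S) :
    (fun k => g (setSnd x z k)) = setSnd (g x) (fun k => g (z k)) := by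
  ext i; simp only [setSnd]; split_ifs <;> rfl

variable [MeasurableSpace S]

lemma measurable_setFst : Measurable (fun p : S × (Fin m → S) => setFst p.1 p.2) := by
  refine measurable_pi_iff.2 fun i => ?_
  simp only [setFst]
  split_ifs <;> fun_prop

lemma measurable_setSnd : Measurable (fun p : S × (Fin m → S) => setSnd p.1 p.2) := by
  refine measurable_pi_iff.2 fun i => ?_
  simp only [setSnd]
  split_ifs <;> fun_prop

lemma measurable_setFst_setSnd :
    Measurable (fun p : (S × S) × (Fin m → S) => setFst p.1.1 (setSnd p.1.2 p.2)) :=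
  measurable_setFst.comp (measurable_fst.fst.prodMk
    (measurable_setSnd.comp (measurable_fst.snd.prodMk measurable_snd)))

variable (μ : Measure S) [IsProbabilityMeasure μ]

lemma measurePreserving_setFst (hm : 2 ≤ m) :
    MeasurePreserving (fun p : S × (Fin m → S) => setFst p.1 p.2)
      (μ.prod (Measure.pi fun _ => μ)) (Measure.pi fun _ => μ) := by
  simp_rw [setFst_eq_update hm]
  exact measurePreserving_resample μ _

lemma measurePreserving_setSnd (hm : 2 ≤ m) :
    MeasurePreserving (fun p : S × (Fin m → S) => setSnd p.1 p.2)
      (μ.prod (Measure.pi fun _ => μ)) (Measure.pi fun _ => μ) := by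
  simp_rw [setSnd_eq_update hm]
  exact measurePreserving_resample μ _

lemma measurePreserving_setFst_setSnd (hm : 2 ≤ m) :
    MeasurePreserving (fun p : (S × S) × (Fin m → S) => setFst p.1.1 (setSnd p.1.2 p.2))
      ((μ.prod μ).prod (Measure.pi fun _ => μ)) (Measure.pi fun _ => μ) :=
  (measurePreserving_setFst μ hm).comp
    (((MeasurePreserving.id μ).prod (measurePreserving_setSnd μ hm)).comp
      (measurePreserving_prodAssoc μ μ (Measure.pi fun _ => μ)))

end Tuples

/-! ### Degeneracy and `L²` boundedness of the second-order projection. -/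

section Degeneracy

variable {T : Type*} [MeasurableSpace T] {m : ℕ} {D : (Fin m → T) → ℝ}

lemma measurable_h2 (hD : Measurable D) (μ : Measure T) [IsProbabilityMeasure μ] :
    Measurable (fun p : T × T => h2 D μ p.1 p.2) := by
  have h1 : Measurable fun p : T × T =>
      ∫ z, D (setFst p.1 (setSnd p.2 z)) ∂(Measure.pi fun _ : Fin m => μ) :=
    (StronglyMeasurable.integral_prod_right (f := fun (p : T × T) z =>
      D (setFst p.1 (setSnd p.2 z)))
      (hD.comp measurable_setFst_setSnd).stronglyMeasurable).measurable
  have h2 : Measurable fun x : T =>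
      ∫ z, D (setFst x z) ∂(Measure.pi fun _ : Fin m => μ) :=
    (StronglyMeasurable.integral_prod_right (f := fun (x : T) z => D (setFst x z))
      (hD.comp measurable_setFst).stronglyMeasurable).measurable
  have h3 : Measurable fun x : T =>
      ∫ z, D (setSnd x z) ∂(Measure.pi fun _ : Fin m => μ) :=
    (StronglyMeasurable.integral_prod_right (f := fun (x : T) z => D (setSnd x z))
      (hD.comp measurable_setSnd).stronglyMeasurable).measurable
  exact ((h1.sub (h2.comp measurable_fst)).sub (h3.comp measurable_snd)).add_const _

lemma measurable_uStat (hD : Measurable D) (μ : Measure T) [IsProbabilityMeasure μ] (n : ℕ) :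
    Measurable (uStat D μ n) := by
  unfold uStat
  refine Measurable.const_mul (Finset.measurable_sum _ fun p _ => ?_) _
  exact (measurable_h2 hD μ).comp
    (Measurable.prodMk (f := fun x : Fin n → T => x p.1) (by fun_prop)
      (g := fun x : Fin n → T => x p.2) (by fun_prop))

variable {μ : Measure T} [IsProbabilityMeasure μ]

lemma integral_sub_sub_const_add_const {f g : T → ℝ} (hf : Integrable f μ) (hg : Integrable g μ)
    (c d : ℝ) :
    ∫ x, (f x - g x - c + d) ∂μ = ∫ x, f x ∂μ - ∫ x, g x ∂μ - c + d := by
  have h1 : Integrable (fun x => f x - g x) μ := hf.sub hg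
  have h2 : Integrable (fun x => f x - g x - c) μ := h1.sub (integrable_const c)
  rw [integral_add h2 (integrable_const d), integral_sub h1 (integrable_const c),
    integral_sub hf hg]
  simp

/-- Fubini for a function pulled back along a measure preserving map on a product. -/
lemma integral_integral_of_measurePreserving {α β γ : Type*} [MeasurableSpace α]
    [MeasurableSpace β] [MeasurableSpace γ] {μ : Measure α} {ν : Measure β} {ρ : Measure γ}
    [SFinite μ] [SFinite ν] {e : α × β → γ} (he : MeasurePreserving e (μ.prod ν) ρ) {G : γ → ℝ}
    (hG : Integrable G ρ) :
    Integrable (fun x => ∫ z, G (e (x, z)) ∂ν) μ ∧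
      ∫ x, ∫ z, G (e (x, z)) ∂ν ∂μ = ∫ z, G z ∂ρ := by
  have hi : Integrable (fun p => G (e p)) (μ.prod ν) := he.integrable_comp_of_integrable hG
  refine ⟨hi.integral_prod_left, ?_⟩
  rw [← integral_prod _ hi, ← he.map_eq, integral_map he.measurable.aemeasurable]
  rw [he.map_eq]
  exact hG.aestronglyMeasurable

/-- The kernel `h₂` is degenerate in its first argument. -/
lemma integral_h2_left (hm : 2 ≤ m) (hint : Integrable D (Measure.pi fun _ => μ)) :
    ∀ᵐ y ∂μ, ∫ x, h2 D μ x y ∂μ = 0 := by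
  have hF := measurePreserving_setFst μ hm
  filter_upwards [((measurePreserving_setSnd μ hm).integrable_comp_of_integrable
    hint).prod_right_ae] with y hy
  obtain ⟨iA, hA⟩ := integral_integral_of_measurePreserving hF hy
  obtain ⟨iB, hB⟩ := integral_integral_of_measurePreserving hF hint
  simp only [Function.comp_apply, ← setFst_setSnd_comm] at iA hA
  unfold h2
  -- Averaging over `x` turns the first term of `h2` into the third and the second into the fourth,
  -- so everything cancels.
  rw [integral_sub_sub_const_add_const iA iB, hA, hB]
  ring

/-- The kernel `h₂` is degenerate in its second argument. -/
lemma integral_h2_right (hm : 2 ≤ m) (hint : Integrable D (Measure.pi fun _ => μ)) :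
    ∀ᵐ x ∂μ, ∫ y, h2 D μ x y ∂μ = 0 := by
  have hS := measurePreserving_setSnd μ hm
  filter_upwards [((measurePreserving_setFst μ hm).integrable_comp_of_integrable
    hint).prod_right_ae] with x hx
  obtain ⟨iA, hA⟩ := integral_integral_of_measurePreserving hS hx
  obtain ⟨iB, hB⟩ := integral_integral_of_measurePreserving hS hint
  simp only [Function.comp_apply] at iA hA
  unfold h2
  simp_rw [sub_right_comm _ (∫ z, D (setFst x z) ∂_)]
  rw [integral_sub_sub_const_add_const iA iB, hA, hB]
  ring

lemma enorm_integral_sq_le {α : Type*} [MeasurableSpace α] (ν : Measure α)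
    [IsProbabilityMeasure ν] {f : α → ℝ} (hf : Measurable f) :
    ‖∫ z, f z ∂ν‖ₑ ^ 2 ≤ ∫⁻ z, ‖f z‖ₑ ^ 2 ∂ν := by
  have h1 : ‖∫ z, f z ∂ν‖ₑ ≤ eLpNorm f 2 ν := by
    refine (enorm_integral_le_lintegral_enorm f).trans ?_
    rw [← eLpNorm_one_eq_lintegral_enorm]
    exact eLpNorm_le_eLpNorm_of_exponent_le (by norm_num) hf.aestronglyMeasurable
  calc ‖∫ z, f z ∂ν‖ₑ ^ 2 ≤ (eLpNorm f 2 ν) ^ 2 := by gcongr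
    _ = ∫⁻ z, ‖f z‖ₑ ^ 2 ∂ν := by
      have := eLpNorm_nnreal_pow_eq_lintegral (f := f) (μ := ν) (p := 2) (by norm_num)
      simpa using this

lemma enorm_sub_sub_add_sq_le (a b c d : ℝ) :
    ‖a - b - c + d‖ₑ ^ 2 ≤ 4 * (‖a‖ₑ ^ 2 + ‖b‖ₑ ^ 2 + ‖c‖ₑ ^ 2 + ‖d‖ₑ ^ 2) := by
  have h (x : ℝ) : ‖x‖ₑ ^ 2 = ENNReal.ofReal (x ^ 2) := by
    rw [← ofReal_norm, ← ENNReal.ofReal_pow (norm_nonneg _), Real.norm_eq_abs, sq_abs]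
  have h4 : (4 : ℝ≥0∞) = ENNReal.ofReal 4 := by norm_num
  simp_rw [h]
  rw [h4, ← ENNReal.ofReal_add (by positivity) (by positivity),
    ← ENNReal.ofReal_add (by positivity) (by positivity),
    ← ENNReal.ofReal_add (by positivity) (by positivity), ← ENNReal.ofReal_mul (by norm_num)]
  refine ENNReal.ofReal_le_ofReal ?_
  -- The difference of the two sides is exactly the sum of these six squares.
  nlinarith [sq_nonneg (a + b), sq_nonneg (a + c), sq_nonneg (a - d), sq_nonneg (b - c),
    sq_nonneg (b + d), sq_nonneg (c + d)]

/-- The projection `D ↦ h₂` is bounded in `L²`. -/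
lemma lintegral_h2_sq_le (hm : 2 ≤ m) (hD : Measurable D) :
    ∫⁻ p, ‖h2 D μ p.1 p.2‖ₑ ^ 2 ∂(μ.prod μ)
      ≤ 16 * ∫⁻ z, ‖D z‖ₑ ^ 2 ∂(Measure.pi fun _ : Fin m => μ) := by
  set ν := Measure.pi fun _ : Fin m => μ with hν
  set I := ∫⁻ z, ‖D z‖ₑ ^ 2 ∂ν
  have hD2 : Measurable fun z => ‖D z‖ₑ ^ 2 := hD.enorm.pow_const 2
  have hF : Measurable fun x => ∫⁻ z, ‖D (setFst x z)‖ₑ ^ 2 ∂ν :=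
    (hD2.comp measurable_setFst).lintegral_prod_right'
  have hS : Measurable fun x => ∫⁻ z, ‖D (setSnd x z)‖ₑ ^ 2 ∂ν :=
    (hD2.comp measurable_setSnd).lintegral_prod_right'
  have hFS : Measurable fun p : T × T => ∫⁻ z, ‖D (setFst p.1 (setSnd p.2 z))‖ₑ ^ 2 ∂ν :=
    (hD2.comp measurable_setFst_setSnd).lintegral_prod_right'
  have eFS : ∫⁻ p : T × T, ∫⁻ z, ‖D (setFst p.1 (setSnd p.2 z))‖ₑ ^ 2 ∂ν ∂(μ.prod μ) = I := by
    rw [← lintegral_prod (fun q : (T × T) × (Fin m → T) =>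
      ‖D (setFst q.1.1 (setSnd q.1.2 q.2))‖ₑ ^ 2)
      (hD2.comp measurable_setFst_setSnd).aemeasurable]
    exact (measurePreserving_setFst_setSnd μ hm).lintegral_comp hD2
  have eF : ∫⁻ p : T × T, ∫⁻ z, ‖D (setFst p.1 z)‖ₑ ^ 2 ∂ν ∂(μ.prod μ) = I := by
    rw [measurePreserving_fst.lintegral_comp hF, ← lintegral_prod (fun q : T × (Fin m → T) =>
      ‖D (setFst q.1 q.2)‖ₑ ^ 2) (hD2.comp measurable_setFst).aemeasurable]
    exact (measurePreserving_setFst μ hm).lintegral_comp hD2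
  have eS : ∫⁻ p : T × T, ∫⁻ z, ‖D (setSnd p.2 z)‖ₑ ^ 2 ∂ν ∂(μ.prod μ) = I := by
    rw [measurePreserving_snd.lintegral_comp hS, ← lintegral_prod (fun q : T × (Fin m → T) =>
      ‖D (setSnd q.1 q.2)‖ₑ ^ 2) (hD2.comp measurable_setSnd).aemeasurable]
    exact (measurePreserving_setSnd μ hm).lintegral_comp hD2
  calc ∫⁻ p, ‖h2 D μ p.1 p.2‖ₑ ^ 2 ∂(μ.prod μ)
      ≤ ∫⁻ p, 4 * ((∫⁻ z, ‖D (setFst p.1 (setSnd p.2 z))‖ₑ ^ 2 ∂ν)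
          + (∫⁻ z, ‖D (setFst p.1 z)‖ₑ ^ 2 ∂ν) + (∫⁻ z, ‖D (setSnd p.2 z)‖ₑ ^ 2 ∂ν) + I)
          ∂(μ.prod μ) := by
        refine lintegral_mono fun p => (enorm_sub_sub_add_sq_le _ _ _ _).trans ?_
        gcongr <;> refine enorm_integral_sq_le ν ?_
        · exact hD.comp (measurable_setFst_setSnd.comp (measurable_const.prodMk measurable_id))
        · exact hD.comp (measurable_setFst.comp (measurable_const.prodMk measurable_id))
        · exact hD.comp (measurable_setSnd.comp (measurable_const.prodMk measurable_id))
        · exact hD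
    -- Each of the four terms integrates to `I` because resampling entries preserves the product
    -- law; with the factor 4 this gives 16.
    _ = 16 * I := by
        have hF' : Measurable fun p : T × T => ∫⁻ z, ‖D (setFst p.1 z)‖ₑ ^ 2 ∂ν :=
          hF.comp measurable_fst
        have hS' : Measurable fun p : T × T => ∫⁻ z, ‖D (setSnd p.2 z)‖ₑ ^ 2 ∂ν :=
          hS.comp measurable_snd
        rw [lintegral_const_mul' _ _ (by norm_num),
          lintegral_add_right _ measurable_const,
          lintegral_add_right _ hS',
          lintegral_add_right _ hF', eFS, eF, eS, lintegral_const,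
          measure_univ]
        ring

end Degeneracy

/-! ### Orthogonality and the second moment of the degenerate statistic. -/

section SecondMoment

variable {T : Type*} [MeasurableSpace T] {μ : Measure T} [IsProbabilityMeasure μ]

/-- Resampling coordinate `a` preserves the law and leaves `Q` and `w b` alone, so the inner
integral over the new coordinate vanishes by degeneracy. In the non-integrable case the Bochner
integral is zero by convention. -/
lemma integral_mul_eq_zero_of_degenerate {ι : Type*} [Fintype ι] [DecidableEq ι] {a b : ι}
    (hab : a ≠ b) {K : T → T → ℝ} (hdeg : ∀ᵐ y ∂μ, ∫ x, K x y ∂μ = 0) {Q : (ι → T) → ℝ}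
    (hQ : ∀ w x, Q (Function.update w a x) = Q w) :
    ∫ w, K (w a) (w b) * Q w ∂(Measure.pi fun _ : ι => μ) = 0 := by
  by_cases hint : Integrable (fun w => K (w a) (w b) * Q w) (Measure.pi fun _ : ι => μ)
  swap
  · exact integral_undef hint
  have hr := measurePreserving_resample μ a
  have hi : Integrable (fun p : T × (ι → T) =>
      K (Function.update p.2 a p.1 a) (Function.update p.2 a p.1 b) *
        Q (Function.update p.2 a p.1)) (μ.prod (Measure.pi fun _ : ι => μ)) :=
    hr.integrable_comp_of_integrable hint
  have hae : ∀ᵐ w ∂(Measure.pi fun _ : ι => μ), ∫ x, K x (w b) ∂μ = 0 :=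
    (measurePreserving_eval (fun _ : ι => μ) b).quasiMeasurePreserving.ae hdeg
  have hint' := hint.aestronglyMeasurable
  rw [← hr.map_eq] at hint' ⊢
  rw [integral_map hr.measurable.aemeasurable hint', integral_prod_symm _ hi]
  refine integral_eq_zero_of_ae ?_
  filter_upwards [hae] with w hw
  simp [hQ, Function.update_of_ne hab.symm, integral_mul_const, hw]

lemma memLp_two_iff_lintegral {α : Type*} [MeasurableSpace α] {ν : Measure α} {f : α → ℝ}
    (hf : Measurable f) : MemLp f 2 ν ↔ ∫⁻ z, ‖f z‖ₑ ^ 2 ∂ν < ∞ := by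
  have h := eLpNorm_nnreal_pow_eq_lintegral (f := f) (μ := ν) (p := 2) (by norm_num)
  simp only [ENNReal.coe_ofNat, NNReal.coe_ofNat, ENNReal.rpow_ofNat] at h
  rw [← h, MemLp]
  simp [hf.aestronglyMeasurable]

lemma lintegral_enorm_sq_eq_ofReal {α : Type*} [MeasurableSpace α] {ν : Measure α} {f : α → ℝ}
    (hf : MemLp f 2 ν) : ∫⁻ z, ‖f z‖ₑ ^ 2 ∂ν = ENNReal.ofReal (∫ z, f z ^ 2 ∂ν) := by
  rw [ofReal_integral_eq_lintegral_ofReal hf.integrable_sq (ae_of_all _ fun _ => sq_nonneg _)]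
  refine lintegral_congr fun z => ?_
  rw [← ofReal_norm, ← ENNReal.ofReal_pow (norm_nonneg _), Real.norm_eq_abs, sq_abs]

variable {m : ℕ} {D : (Fin m → T) → ℝ}

lemma memLp_h2 (hm : 2 ≤ m) (hD : Measurable D) (hD2 : MemLp D 2 (Measure.pi fun _ => μ)) :
    MemLp (fun p : T × T => h2 D μ p.1 p.2) 2 (μ.prod μ) := by
  rw [memLp_two_iff_lintegral (measurable_h2 hD μ)]
  exact (lintegral_h2_sq_le hm hD).trans_lt
    (ENNReal.mul_lt_top (by norm_num) ((memLp_two_iff_lintegral hD).1 hD2))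

/-- Products of `h₂` over two different pairs of indices are orthogonal. -/
lemma integral_h2_mul_h2_eq_zero (hm : 2 ≤ m) (hD2 : MemLp D 2 (Measure.pi fun _ => μ)) {n : ℕ}
    {p q : Fin n × Fin n} (hp : p.1 ≠ p.2) (hq : q.1 ≠ q.2) (h1 : q ≠ p) (h2' : q ≠ p.swap) :
    ∫ w, h2 D μ (w p.1) (w p.2) * h2 D μ (w q.1) (w q.2) ∂(Measure.pi fun _ : Fin n => μ)
      = 0 := by
  have hint : Integrable D (Measure.pi fun _ => μ) := hD2.integrable (by norm_num)
  obtain ⟨p1, p2⟩ := p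
  obtain ⟨q1, q2⟩ := q
  simp only [ne_eq, Prod.mk.injEq, Prod.swap_prod_mk, not_and] at *
  -- The unordered pairs differ, so some endpoint of `p` does not occur in `q`. Resampling that
  -- coordinate affects only the first factor.
  by_cases hc : q1 ≠ p1 ∧ q2 ≠ p1
  · exact integral_mul_eq_zero_of_degenerate hp (integral_h2_left hm hint)
      (Q := fun w => h2 D μ (w q1) (w q2)) fun w x => by
        simp [Function.update_of_ne hc.1, Function.update_of_ne hc.2]
  · have hc' : q1 ≠ p2 ∧ q2 ≠ p2 := by
      constructor <;> rintro rfl <;> grind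
    exact integral_mul_eq_zero_of_degenerate (Ne.symm hp) (K := fun x y => h2 D μ y x)
      (integral_h2_right hm hint)
      (Q := fun w => h2 D μ (w q1) (w q2)) fun w x => by
        simp [Function.update_of_ne hc'.1, Function.update_of_ne hc'.2]

/-- The second moment of the degenerate statistic is bounded by that of the kernel. -/
lemma lintegral_uStat_sq_le (hm : 2 ≤ m) (hD : Measurable D)
    (hD2 : MemLp D 2 (Measure.pi fun _ => μ)) {n : ℕ} :
    ∫⁻ w, ‖uStat D μ n w‖ₑ ^ 2 ∂(Measure.pi fun _ : Fin n => μ)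
      ≤ 32 * ∫⁻ z, ‖D z‖ₑ ^ 2 ∂(Measure.pi fun _ : Fin m => μ) := by
  set ν := Measure.pi fun _ : Fin n => μ
  set M := ∫ p, (h2 D μ p.1 p.2) ^ 2 ∂(μ.prod μ)
  have hK := memLp_h2 hm hD hD2
  have hM0 : 0 ≤ M := integral_nonneg fun _ => sq_nonneg _
  let K : Fin n × Fin n → (Fin n → T) → ℝ := fun p w => h2 D μ (w p.1) (w p.2)
  have hKp : ∀ p : Fin n × Fin n, p.1 ≠ p.2 → MemLp (K p) 2 ν := fun p hp =>
    hK.comp_measurePreserving (measurePreserving_eval_pair μ hp)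
  have hKM : ∀ p : Fin n × Fin n, p.1 ≠ p.2 → ∫ w, K p w ^ 2 ∂ν = M := fun p hp => by
    have hmp := measurePreserving_eval_pair μ hp
    have hmeas : Measurable fun p : T × T => h2 D μ p.1 p.2 ^ 2 :=
      (measurable_h2 hD μ).pow_const 2
    simp only [M]
    rw [← hmp.map_eq, integral_map hmp.measurable.aemeasurable hmeas.aestronglyMeasurable]
  have hKK : ∀ p q : Fin n × Fin n, p.1 ≠ p.2 → q.1 ≠ q.2 →
      Integrable (fun w => K p w * K q w) ν := fun p q hp hq => (hKp p hp).integrable_mul (hKp q hq)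
  -- A pair correlates only with itself and its reversal, and each such correlation is at most `M`
  -- since `2ab ≤ a² + b²`. Symmetry of the kernel is not needed here.
  have hpq : ∀ p q : Fin n × Fin n, p.1 ≠ p.2 → q.1 ≠ q.2 →
      ∫ w, K p w * K q w ∂ν ≤ (if q = p then M else 0) + (if q = p.swap then M else 0) := by
    intro p q hp hq
    by_cases hc : q ≠ p ∧ q ≠ p.swap
    · rw [show ∫ w, K p w * K q w ∂ν = 0 from
        integral_h2_mul_h2_eq_zero hm hD2 hp hq hc.1 hc.2]
      positivity
    · have hle : ∫ w, K p w * K q w ∂ν ≤ M := by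
        have hmono : ∫ w, K p w * K q w ∂ν ≤ ∫ w, (K p w ^ 2 / 2 + K q w ^ 2 / 2) ∂ν := by
          refine integral_mono (hKK p q hp hq)
            (((hKp p hp).integrable_sq.div_const 2).add ((hKp q hq).integrable_sq.div_const 2))
            fun w => ?_
          have := two_mul_le_add_sq (K p w) (K q w)
          simp only
          linarith
        rw [integral_add ((hKp p hp).integrable_sq.div_const 2)
          ((hKp q hq).integrable_sq.div_const 2), integral_div, integral_div, hKM p hp,
          hKM q hq] at hmono
        linarith
      refine hle.trans ?_
      by_cases h1 : q = p
      · rw [if_pos h1]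
        have : 0 ≤ (if q = p.swap then M else 0) := by positivity
        linarith
      · have h2 : q = p.swap := by by_contra h; exact hc ⟨h1, h⟩
        rw [if_pos h2]
        have : 0 ≤ (if q = p then M else 0) := by positivity
        linarith
  have hsum : ∫ w, (∑ p ∈ (Finset.univ : Finset (Fin n)).offDiag, K p w) ^ 2 ∂ν
      ≤ 2 * (n : ℝ) ^ 2 * M := by
    have hexp : ∀ w, (∑ p ∈ (Finset.univ : Finset (Fin n)).offDiag, K p w) ^ 2
        = ∑ p ∈ (Finset.univ : Finset (Fin n)).offDiag,
          ∑ q ∈ (Finset.univ : Finset (Fin n)).offDiag, K p w * K q w := fun w => by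
      rw [sq, Finset.sum_mul_sum]
    have hoff : ∀ p ∈ (Finset.univ : Finset (Fin n)).offDiag, p.1 ≠ p.2 := fun p hp =>
      (Finset.mem_offDiag.1 hp).2.2
    simp_rw [hexp]
    rw [integral_finsetSum _ fun p hp => integrable_finsetSum _ fun q hq =>
      hKK p q (hoff p hp) (hoff q hq)]
    calc _ ≤ ∑ p ∈ (Finset.univ : Finset (Fin n)).offDiag, 2 * M := by
          refine Finset.sum_le_sum fun p hp => ?_
          rw [integral_finsetSum _ fun q hq =>
            hKK p q (hoff p hp) (hoff q hq)]
          refine (Finset.sum_le_sum fun q hq => hpq p q (hoff p hp) (hoff q hq)).trans ?_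
          rw [Finset.sum_add_distrib, Finset.sum_ite_eq', Finset.sum_ite_eq', two_mul]
          gcongr <;> split_ifs <;> simp [hM0]
      _ ≤ 2 * (n : ℝ) ^ 2 * M := by
          rw [Finset.sum_const, nsmul_eq_mul, Finset.offDiag_card, Finset.card_univ,
            Fintype.card_fin]
          have : ((n * n - n : ℕ) : ℝ) ≤ (n : ℝ) ^ 2 := by
            rw [sq]; exact_mod_cast Nat.sub_le _ _
          nlinarith
  have hUmem : MemLp (uStat D μ n) 2 ν := by
    have : MemLp (fun w => ∑ p ∈ (Finset.univ : Finset (Fin n)).offDiag, K p w) 2 ν :=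
      memLp_finsetSum _ fun p hp => hKp p (Finset.mem_offDiag.1 hp).2.2
    exact this.const_mul _
  have hreal : ∫ w, uStat D μ n w ^ 2 ∂ν ≤ 2 * M := by
    have : ∀ w, uStat D μ n w ^ 2
        = (1 / (n : ℝ)) ^ 2 * (∑ p ∈ (Finset.univ : Finset (Fin n)).offDiag, K p w) ^ 2 :=
      fun w => mul_pow _ _ _
    simp_rw [this]
    rw [integral_const_mul]
    rcases Nat.eq_zero_or_pos n with hn | hn
    · subst hn; simpa using hM0
    · have hn' : (0 : ℝ) < n := by exact_mod_cast hn
      calc _ ≤ (1 / (n : ℝ)) ^ 2 * (2 * (n : ℝ) ^ 2 * M) := by gcongr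
        _ = 2 * M := by field_simp
  calc _ = ENNReal.ofReal (∫ w, uStat D μ n w ^ 2 ∂ν) := lintegral_enorm_sq_eq_ofReal hUmem
    _ ≤ ENNReal.ofReal (2 * M) := ENNReal.ofReal_le_ofReal hreal
    _ = 2 * ∫⁻ p, ‖h2 D μ p.1 p.2‖ₑ ^ 2 ∂(μ.prod μ) := by
        rw [ENNReal.ofReal_mul (by norm_num), lintegral_enorm_sq_eq_ofReal hK]; simp [M]
    _ ≤ 2 * (16 * ∫⁻ z, ‖D z‖ₑ ^ 2 ∂(Measure.pi fun _ : Fin m => μ)) := by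
        gcongr; exact lintegral_h2_sq_le hm hD
    _ = _ := by rw [← mul_assoc]; norm_num

end SecondMoment

/-! ### From a coupling of the laws to a coupling of the statistics. -/

section Coupling

variable {S : Type*} [MeasurableSpace S] {m : ℕ} {h : (Fin m → S) → ℝ}

/-- The difference of a kernel evaluated at the two components of a tuple of pairs. -/
def diffKernel (h : (Fin m → S) → ℝ) (w : Fin m → S × S) : ℝ :=
  h (fun k => (w k).1) - h (fun k => (w k).2)

lemma measurable_diffKernel (hh : Measurable h) : Measurable (diffKernel h) :=
  (hh.comp (by fun_prop)).sub (hh.comp (by fun_prop))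

variable {π : Measure (S × S)} [IsProbabilityMeasure π] {G F : Measure S}
  [IsProbabilityMeasure G] [IsProbabilityMeasure F]

lemma measurePreserving_pi_comp {T : Type*} [MeasurableSpace T] {ι : Type*} [Fintype ι]
    {ρ : Measure T} [IsProbabilityMeasure ρ] {g : T → S} (hg : MeasurePreserving g ρ G) :
    MeasurePreserving (fun (w : ι → T) k => g (w k)) (Measure.pi fun _ => ρ)
      (Measure.pi fun _ => G) :=
  measurePreserving_pi _ _ fun _ => hg

lemma memLp_diffKernel (hG : MeasurePreserving Prod.fst π G) (hF : MeasurePreserving Prod.snd π F)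
    (h1 : MemLp h 2 (Measure.pi fun _ => G)) (h2 : MemLp h 2 (Measure.pi fun _ => F)) :
    MemLp (diffKernel h) 2 (Measure.pi fun _ => π) :=
  (h1.comp_measurePreserving (measurePreserving_pi_comp hG)).sub
    (h2.comp_measurePreserving (measurePreserving_pi_comp hF))

/-- The kernel `h₂` of a marginal, as an integral against the coupling. -/
lemma ae_h2_diffKernel (hm : 2 ≤ m) (hh : Measurable h)
    (hG : MeasurePreserving Prod.fst π G) (hF : MeasurePreserving Prod.snd π F)
    (h1 : Integrable h (Measure.pi fun _ => G)) (h2' : Integrable h (Measure.pi fun _ => F)) :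
    ∀ᵐ p ∂(π.prod π), h2 (diffKernel h) π p.1 p.2
      = h2 h G p.1.1 p.2.1 - h2 h F p.1.2 p.2.2 := by
  have key : ∀ {g : S × S → S} {H : Measure S} [IsProbabilityMeasure H],
      MeasurePreserving g π H → ∀ f : (Fin m → S) → ℝ, Measurable f →
      ∫ w, f (fun k => g (w k)) ∂(Measure.pi fun _ : Fin m => π)
        = ∫ z, f z ∂(Measure.pi fun _ : Fin m => H) := by
    intro g H _ hg f hf
    have hmp := measurePreserving_pi_comp (ι := Fin m) hg
    rw [← hmp.map_eq, integral_map hmp.measurable.aemeasurable hf.aestronglyMeasurable]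
  -- Splitting the integrals of differences needs integrable sections, which Fubini provides only
  -- for almost every `p`.
  have hae : ∀ {g : S × S → S} {H : Measure S} [IsProbabilityMeasure H],
      MeasurePreserving g π H → Integrable h (Measure.pi fun _ => H) →
      ∀ᵐ p ∂(π.prod π),
        Integrable (fun w : Fin m → S × S => h (fun k => g (setFst p.1 (setSnd p.2 w) k)))
          (Measure.pi fun _ => π) ∧
        Integrable (fun w : Fin m → S × S => h (fun k => g (setFst p.1 w k)))
          (Measure.pi fun _ => π) ∧
        Integrable (fun w : Fin m → S × S => h (fun k => g (setSnd p.2 w k)))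
          (Measure.pi fun _ => π) := by
    intro g H _ hg hint
    have hmp := (measurePreserving_pi_comp (ι := Fin m) hg).integrable_comp_of_integrable hint
    have a1 := ((measurePreserving_setFst_setSnd π hm).integrable_comp_of_integrable
      hmp).prod_right_ae
    have a2 := measurePreserving_fst (μ := π) (ν := π) |>.quasiMeasurePreserving.ae
      ((measurePreserving_setFst π hm).integrable_comp_of_integrable hmp).prod_right_ae
    have a3 := measurePreserving_snd (μ := π) (ν := π) |>.quasiMeasurePreserving.ae
      ((measurePreserving_setSnd π hm).integrable_comp_of_integrable hmp).prod_right_ae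
    filter_upwards [a1, a2, a3] with p b1 b2 b3
    exact ⟨b1, b2, b3⟩
  have m1 : ∀ x y : S, Measurable fun z : Fin m → S => h (setFst x (setSnd y z)) := fun x y =>
    hh.comp (measurable_setFst_setSnd.comp (measurable_const.prodMk measurable_id)
      (f := fun z : Fin m → S => ((x, y), z)))
  have m2 : ∀ x : S, Measurable fun z : Fin m → S => h (setFst x z) := fun x =>
    hh.comp (measurable_setFst.comp (measurable_const.prodMk measurable_id))
  have m3 : ∀ x : S, Measurable fun z : Fin m → S => h (setSnd x z) := fun x =>
    hh.comp (measurable_setSnd.comp (measurable_const.prodMk measurable_id))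
  have i1 : Integrable (fun w : Fin m → S × S => h fun k => (w k).1) (Measure.pi fun _ => π) :=
    (measurePreserving_pi_comp (ι := Fin m) hG).integrable_comp_of_integrable h1
  have i2 : Integrable (fun w : Fin m → S × S => h fun k => (w k).2) (Measure.pi fun _ => π) :=
    (measurePreserving_pi_comp (ι := Fin m) hF).integrable_comp_of_integrable h2'
  filter_upwards [hae hG h1, hae hF h2'] with p hp1 hp2
  unfold h2 diffKernel
  rw [integral_sub hp1.1 hp2.1, integral_sub hp1.2.1 hp2.2.1, integral_sub hp1.2.2 hp2.2.2,
    integral_sub i1 i2]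
  simp only [comp_setFst, comp_setSnd]
  rw [key hG _ (m1 _ _), key hG _ (m2 _), key hG _ (m3 _), key hG _ hh,
    key hF _ (m1 _ _), key hF _ (m2 _), key hF _ (m3 _), key hF _ hh]
  ring

/-- Only pairs of distinct indices enter, and for these `(w p.1, w p.2)` has law `π.prod π`, so the
almost sure identity for `h2` can be pulled back. -/
lemma ae_uStat_diffKernel (hm : 2 ≤ m) (hh : Measurable h)
    (hG : MeasurePreserving Prod.fst π G) (hF : MeasurePreserving Prod.snd π F)
    (h1 : Integrable h (Measure.pi fun _ => G)) (h2' : Integrable h (Measure.pi fun _ => F))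
    (n : ℕ) :
    ∀ᵐ w ∂(Measure.pi fun _ : Fin n => π), uStat (diffKernel h) π n w
      = uStat h G n (fun i => (w i).1) - uStat h F n (fun i => (w i).2) := by
  have hae : ∀ p ∈ (Finset.univ : Finset (Fin n)).offDiag,
      ∀ᵐ w ∂(Measure.pi fun _ : Fin n => π), h2 (diffKernel h) π (w p.1) (w p.2)
        = h2 h G (w p.1).1 (w p.2).1 - h2 h F (w p.1).2 (w p.2).2 := fun p hp =>
    (measurePreserving_eval_pair π (Finset.mem_offDiag.1 hp).2.2).quasiMeasurePreserving.ae
      (ae_h2_diffKernel hm hh hG hF h1 h2')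
  rw [← Finset.eventually_all] at hae
  filter_upwards [hae] with w hw
  unfold uStat
  rw [← mul_sub, ← Finset.sum_sub_distrib]
  congr 1
  exact Finset.sum_congr rfl hw

/-- A coupling of `G` and `F` bounds the distance of the laws of the two statistics. -/
lemma d2_uStat_le (hm : 2 ≤ m) (hh : Measurable h)
    (hG : MeasurePreserving Prod.fst π G) (hF : MeasurePreserving Prod.snd π F)
    (h1 : MemLp h 2 (Measure.pi fun _ => G)) (h2 : MemLp h 2 (Measure.pi fun _ => F)) (n : ℕ) :
    d2 ((Measure.pi fun _ : Fin n => G).map (uStat h G n))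
      ((Measure.pi fun _ : Fin n => F).map (uStat h F n))
      ≤ (32 * ∫⁻ w, ‖diffKernel h w‖ₑ ^ 2 ∂(Measure.pi fun _ : Fin m => π)) ^ (1 / 2 : ℝ) := by
  have mG := measurable_uStat hh G n
  have mF := measurable_uStat hh F n
  have hG' := measurePreserving_pi_comp (ι := Fin n) hG
  have hF' := measurePreserving_pi_comp (ι := Fin n) hF
  have mGF : Measurable fun w : Fin n → S × S =>
      (uStat h G n (fun i => (w i).1), uStat h F n (fun i => (w i).2)) :=
    (mG.comp hG'.measurable).prodMk (mF.comp hF'.measurable)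
  -- The competitor in the infimum is the joint law of the two statistics on an iid sample from `π`.
  refine (iInf₂_le ((Measure.pi fun _ : Fin n => π).map fun w =>
      (uStat h G n (fun i => (w i).1), uStat h F n (fun i => (w i).2)))
    ⟨Measure.isProbabilityMeasure_map mGF.aemeasurable, ?a, ?b⟩).trans ?c
  case a => rw [Measure.map_map measurable_fst mGF, ← hG'.map_eq, Measure.map_map mG hG'.measurable]; rfl
  case b => rw [Measure.map_map measurable_snd mGF, ← hF'.map_eq, Measure.map_map mF hF'.measurable]; rfl
  case c =>
    gcongr
    rw [lintegral_map (by fun_prop) mGF]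
    refine le_trans (le_of_eq ?_) (lintegral_uStat_sq_le hm (measurable_diffKernel hh)
      (memLp_diffKernel hG hF h1 h2) (n := n))
    refine lintegral_congr_ae ?_
    filter_upwards [ae_uStat_diffKernel hm hh hG hF (h1.integrable (by norm_num))
      (h2.integrable (by norm_num)) n] with w hw
    rw [hw, ← ofReal_norm, ← ENNReal.ofReal_pow (norm_nonneg _), Real.norm_eq_abs]

end Coupling

/-! ### Maximal coupling of the block masses, lifted to the laws. -/

section BlockCoupling

/-- The maximal coupling of two probability vectors. -/
lemma exists_coupling_fintype {ι : Type*} [Fintype ι] [DecidableEq ι] {p q : ι → ℝ≥0∞}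
    (hp : ∑ i, p i = 1) (hq : ∑ i, q i = 1) :
    ∃ κ : ι → ι → ℝ≥0∞, (∀ i, ∑ j, κ i j = p i) ∧ (∀ j, ∑ i, κ i j = q j) ∧
      ∑ i, ∑ j ∈ Finset.univ.erase i, κ i j ≤ ∑ i, (p i - q i) := by
  set c : ι → ℝ≥0∞ := fun i => min (p i) (q i)
  have hcp : ∀ i, c i + (p i - q i) = p i := fun i => by
    rcases le_total (p i) (q i) with h | h
    · simp [c, h, tsub_eq_zero_of_le h]
    · simp [c, h, add_tsub_cancel_of_le]
  have hcq : ∀ i, c i + (q i - p i) = q i := fun i => by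
    rcases le_total (p i) (q i) with h | h
    · simp [c, h, add_tsub_cancel_of_le]
    · simp [c, h, tsub_eq_zero_of_le h]
  set δ := ∑ i, (p i - q i) with hδ
  have h1 : ∑ i, c i + δ = 1 := by
    rw [hδ, ← Finset.sum_add_distrib]; simp_rw [hcp]; exact hp
  have h2 : ∑ i, c i + ∑ i, (q i - p i) = 1 := by
    rw [← Finset.sum_add_distrib]; simp_rw [hcq]; exact hq
  have hctop : ∑ i, c i ≠ ∞ := ne_top_of_le_ne_top ENNReal.one_ne_top (h1 ▸ le_self_add)
  have hδtop : δ ≠ ∞ := ne_top_of_le_ne_top ENNReal.one_ne_top (h1 ▸ le_add_self)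
  -- Both total masses are one, so the excess of `p` over `q` equals that of `q` over `p`.
  have hδ' : ∑ i, (q i - p i) = δ := (ENNReal.add_right_inj hctop).1 (h2.trans h1.symm)
  -- For `δ = 0` the inverse is `∞`, but then `x = 0` and the product is still zero.
  have hcancel : ∀ {x : ℝ≥0∞}, x ≤ δ → x * δ⁻¹ * δ = x := fun {x} hx => by
    rcases eq_or_ne δ 0 with h0 | h0
    · rw [h0] at hx ⊢; simp [nonpos_iff_eq_zero.1 hx]
    · rw [mul_assoc, ENNReal.inv_mul_cancel h0 hδtop, mul_one]
  have hp_le : ∀ i, p i - q i ≤ δ := fun i =>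
    Finset.single_le_sum (f := fun i => p i - q i) (fun _ _ => zero_le) (Finset.mem_univ i)
  have hq_le : ∀ i, q i - p i ≤ δ := fun i => by
    rw [← hδ']
    exact Finset.single_le_sum (f := fun i => q i - p i) (fun _ _ => zero_le) (Finset.mem_univ i)
  -- The common mass stays on the diagonal; the excesses are coupled independently, normalized by
  -- `δ`.
  refine ⟨fun i j => (if i = j then c i else 0) + (p i - q i) * δ⁻¹ * (q j - p j),
    fun i => ?_, fun j => ?_, ?_⟩
  · rw [Finset.sum_add_distrib, Finset.sum_ite_eq, if_pos (Finset.mem_univ i), ← Finset.mul_sum,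
      hδ', hcancel (hp_le i), hcp]
  · rw [Finset.sum_add_distrib, Finset.sum_ite_eq', if_pos (Finset.mem_univ j), ← Finset.sum_mul,
      ← Finset.sum_mul, ← hδ, mul_comm _ (q j - p j), mul_comm δ, ← mul_assoc, hcancel (hq_le j), hcq]
  · refine Finset.sum_le_sum fun i _ => ?_
    calc ∑ j ∈ Finset.univ.erase i, ((if i = j then c i else 0)
          + (p i - q i) * δ⁻¹ * (q j - p j))
        = ∑ j ∈ Finset.univ.erase i, (p i - q i) * δ⁻¹ * (q j - p j) :=
          Finset.sum_congr rfl fun j hj => by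
            rw [if_neg (Finset.ne_of_mem_erase hj).symm, zero_add]
      _ ≤ ∑ j, (p i - q i) * δ⁻¹ * (q j - p j) :=
          Finset.sum_le_sum_of_subset (Finset.erase_subset _ _)
      _ = p i - q i := by rw [← Finset.mul_sum, hδ', hcancel (hp_le i)]

variable {S : Type*} [MeasurableSpace S] {ι : Type*} [Fintype ι] [MeasurableSpace ι]
  [MeasurableSingletonClass ι]

lemma sum_measure_fiber (G : Measure S) [IsProbabilityMeasure G] {b : S → ι}
    (hb : Measurable b) : ∑ i, G (b ⁻¹' {i}) = 1 := by
  have := sum_measure_preimage_singleton (μ := G) (f := b) Finset.univ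
    fun y _ => hb (measurableSet_singleton y)
  simpa using this

lemma sum_smul_cond_fiber (G : Measure S) [IsProbabilityMeasure G] {b : S → ι}
    (hb : Measurable b) : ∑ i, G (b ⁻¹' {i}) • ProbabilityTheory.cond G (b ⁻¹' {i}) = G := by
  have hS : ∀ i, MeasurableSet (b ⁻¹' {i}) := fun i => hb (measurableSet_singleton i)
  ext s hs
  simp only [Measure.coe_finsetSum, Measure.coe_smul, Finset.sum_apply, Pi.smul_apply,
    smul_eq_mul]
  have : ∀ i, G (b ⁻¹' {i}) * ProbabilityTheory.cond G (b ⁻¹' {i}) s = G (b ⁻¹' {i} ∩ s) :=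
    fun i => by rw [mul_comm, cond_mul_eq_inter (hS i)]
  simp_rw [this]
  have h2 := sum_measure_preimage_singleton (μ := G.restrict s) (f := b) Finset.univ
    fun y _ => hS y
  simpa [Measure.restrict_apply (hS _)] using h2

/-- Two laws whose blocks have almost the same masses can be coupled so that the two components
are in the same block with high probability. -/
lemma exists_block_coupling (G F : Measure S) [IsProbabilityMeasure G] [IsProbabilityMeasure F]
    {b : S → ι} (hb : Measurable b) :
    ∃ π : Measure (S × S), IsProbabilityMeasure π ∧ MeasurePreserving Prod.fst π G ∧
      MeasurePreserving Prod.snd π F ∧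
      π {x | b x.1 ≠ b x.2} ≤ ∑ i, (G (b ⁻¹' {i}) - F (b ⁻¹' {i})) := by
  classical
  have hS : ∀ i, MeasurableSet (b ⁻¹' {i}) := fun i => hb (measurableSet_singleton i)
  obtain ⟨κ, h1, h2, h3⟩ := exists_coupling_fintype (sum_measure_fiber G hb)
    (sum_measure_fiber F hb)
  -- Conditioning on a null block gives the zero measure, which is harmless because `κ` vanishes
  -- there.
  have hκ1 : ∀ i j, κ i j * ProbabilityTheory.cond F (b ⁻¹' {j}) Set.univ = κ i j := fun i j => by
    rcases eq_or_ne (F (b ⁻¹' {j})) 0 with h | h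
    · have : κ i j = 0 := by
        rw [← h2 j, Finset.sum_eq_zero_iff] at h
        exact h i (Finset.mem_univ i)
      rw [this, zero_mul]
    · have := cond_isProbabilityMeasure h
      rw [measure_univ, mul_one]
  have hκ2 : ∀ i j, κ i j * ProbabilityTheory.cond G (b ⁻¹' {i}) Set.univ = κ i j := fun i j => by
    rcases eq_or_ne (G (b ⁻¹' {i})) 0 with h | h
    · have : κ i j = 0 := by
        rw [← h1 i, Finset.sum_eq_zero_iff] at h
        exact h j (Finset.mem_univ j)
      rw [this, zero_mul]
    · have := cond_isProbabilityMeasure h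
      rw [measure_univ, mul_one]
  -- Draw a pair of blocks from `κ`, then independent points from `G` and `F` conditioned on these
  -- blocks.
  set π : Measure (S × S) := ∑ i, ∑ j, κ i j •
    (ProbabilityTheory.cond G (b ⁻¹' {i})).prod (ProbabilityTheory.cond F (b ⁻¹' {j})) with hπ
  have hfst : MeasurePreserving Prod.fst π G := by
    refine ⟨measurable_fst, ?_⟩
    rw [hπ, ← Measure.mapₗ_apply_of_measurable measurable_fst]
    simp only [map_sum, map_smul]
    simp only [Measure.mapₗ_apply_of_measurable measurable_fst]
    conv_rhs => rw [← sum_smul_cond_fiber G hb]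
    refine Finset.sum_congr rfl fun i _ => ?_
    simp_rw [Measure.map_fst_prod, smul_smul, hκ1, ← Finset.sum_smul, h1]
  have hsnd : MeasurePreserving Prod.snd π F := by
    refine ⟨measurable_snd, ?_⟩
    rw [hπ, ← Measure.mapₗ_apply_of_measurable measurable_snd]
    simp only [map_sum, map_smul]
    simp only [Measure.mapₗ_apply_of_measurable measurable_snd]
    conv_rhs => rw [← sum_smul_cond_fiber F hb]
    rw [Finset.sum_comm]
    refine Finset.sum_congr rfl fun i _ => ?_
    simp_rw [Measure.map_snd_prod, smul_smul, hκ2, ← Finset.sum_smul, h2]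
  refine ⟨π, ?_, hfst, hsnd, ?_⟩
  · constructor
    rw [← Set.preimage_univ (f := Prod.fst), hfst.measure_preimage MeasurableSet.univ.nullMeasurableSet,
      measure_univ]
  · refine le_trans ?_ h3
    rw [hπ]
    simp only [Measure.coe_finsetSum, Finset.sum_apply, Measure.coe_smul, Pi.smul_apply,
      smul_eq_mul]
    refine Finset.sum_le_sum fun i _ => ?_
    rw [← Finset.add_sum_erase _ _ (Finset.mem_univ i)]
    have hz : ((ProbabilityTheory.cond G (b ⁻¹' {i})).prod (ProbabilityTheory.cond F (b ⁻¹' {i})))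
        {x | b x.1 ≠ b x.2} = 0 := by
      have hsub : {x : S × S | b x.1 ≠ b x.2}
          ⊆ ((b ⁻¹' {i})ᶜ ×ˢ Set.univ) ∪ (Set.univ ×ˢ (b ⁻¹' {i})ᶜ) := by
        rintro ⟨x, y⟩ hxy
        simp only [Set.mem_ofPred_eq, Set.mem_union, Set.mem_prod, Set.mem_compl_iff,
          Set.mem_preimage, Set.mem_singleton_iff, Set.mem_univ, and_true, true_and] at hxy ⊢
        by_contra! hc
        exact hxy (hc.1.trans hc.2.symm)
      have hzero : ∀ H : Measure S, ProbabilityTheory.cond H (b ⁻¹' {i}) (b ⁻¹' {i})ᶜ = 0 :=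
        fun H => by rw [cond_apply (hS i)]; simp
      refine measure_mono_null hsub (measure_union_null ?_ ?_) <;> rw [Measure.prod_prod, hzero] <;>
        simp
    rw [hz, mul_zero, zero_add]
    refine Finset.sum_le_sum fun j _ => ?_
    calc _ ≤ κ i j * 1 := by
          gcongr
          refine (measure_mono (Set.subset_univ _)).trans ?_
          rw [← Set.univ_prod_univ, Measure.prod_prod]
          exact mul_le_one' prob_le_one prob_le_one
      _ = κ i j := mul_one _

end BlockCoupling

/-! ### Density in `L²` of functions of finitely many labels. -/

section BlockFunctions

variable {S : Type*} [MeasurableSpace S] {m : ℕ}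

/-- A function of finitely many measurable labels of the coordinates. -/
def IsBlockFun (g : (Fin m → S) → ℝ) : Prop :=
  ∃ (ι : Type) (_ : Fintype ι) (_ : MeasurableSpace ι) (_ : MeasurableSingletonClass ι)
    (b : S → ι) (g₀ : (Fin m → ι) → ℝ), Measurable b ∧ g = fun z => g₀ fun k => b (z k)

lemma IsBlockFun.measurable {g : (Fin m → S) → ℝ} (hg : IsBlockFun g) : Measurable g := by
  obtain ⟨ι, _, _, _, b, g₀, hb, rfl⟩ := hg
  exact (measurable_of_countable g₀).comp (by fun_prop)

lemma isBlockFun_const (c : ℝ) : IsBlockFun fun _ : Fin m → S => c :=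
  ⟨Unit, inferInstance, inferInstance, inferInstance, fun _ => (), fun _ => c,
    measurable_const, rfl⟩

/-- Pairing the two labellings gives a common finite refinement. -/
lemma IsBlockFun.map₂ {f g : (Fin m → S) → ℝ} (hf : IsBlockFun f) (hg : IsBlockFun g)
    (φ : ℝ → ℝ → ℝ) : IsBlockFun fun z => φ (f z) (g z) := by
  obtain ⟨ι, _, _, _, b, f₀, hb, rfl⟩ := hf
  obtain ⟨ι', _, _, _, b', g₀, hb', rfl⟩ := hg
  exact ⟨ι × ι', inferInstance, inferInstance, inferInstance, fun x => (b x, b' x),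
    fun w => φ (f₀ fun k => (w k).1) (g₀ fun k => (w k).2), hb.prodMk hb', rfl⟩

lemma isBlockFun_indicator_eval {A : Set S} (hA : MeasurableSet A) (k : Fin m) :
    IsBlockFun (((fun z : Fin m → S => z k) ⁻¹' A).indicator fun _ => (1 : ℝ)) := by
  classical
  refine ⟨Bool, inferInstance, inferInstance, inferInstance, fun x => decide (x ∈ A),
    fun w => if w k = true then 1 else 0, ?_, ?_⟩
  · exact measurable_to_bool (by simpa [Set.preimage, decide_eq_true_iff] using hA)
  · ext z
    simp [Set.indicator_apply]

/-- The sets that are unions of blocks. -/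
def blockSets (S : Type*) [MeasurableSpace S] (m : ℕ) : Set (Set (Fin m → S)) :=
  {s | IsBlockFun (s.indicator fun _ => (1 : ℝ))}

lemma isSetRing_blockSets : IsSetRing (blockSets S m) where
  empty_mem := by
    simpa [blockSets] using isBlockFun_const (S := S) (m := m) 0
  union_mem {s t} hs ht := by
    have := IsBlockFun.map₂ hs ht max
    refine (congrArg IsBlockFun ?_).mp this
    ext z
    by_cases h1 : z ∈ s <;> by_cases h2 : z ∈ t <;> simp [h1, h2]
  sdiff_mem {s t} hs ht := by
    have := IsBlockFun.map₂ hs ht fun x y => x * (1 - y)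
    refine (congrArg IsBlockFun ?_).mp this
    ext z
    by_cases h1 : z ∈ s <;> by_cases h2 : z ∈ t <;> simp [h1, h2]

lemma generateFrom_blockSets :
    (MeasurableSpace.pi : MeasurableSpace (Fin m → S))
      = MeasurableSpace.generateFrom (blockSets S m) := by
  refine le_antisymm ?_ (MeasurableSpace.generateFrom_le fun s hs => ?_)
  · refine iSup_le fun k => ?_
    rintro _ ⟨A, hA, rfl⟩
    exact MeasurableSpace.measurableSet_generateFrom (isBlockFun_indicator_eval hA k)
  · have : s = (s.indicator fun _ => (1 : ℝ)) ⁻¹' {1} := by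
      ext z; by_cases hz : z ∈ s <;> simp [hz]
    rw [this]
    exact IsBlockFun.measurable hs (measurableSet_singleton 1)

/-- Block functions are dense in `L²`. -/
lemma exists_isBlockFun_eLpNorm_le {ν : Measure (Fin m → S)} [IsFiniteMeasure ν]
    {h : (Fin m → S) → ℝ} (hh : MemLp h 2 ν) {ε : ℝ≥0∞} (hε : ε ≠ 0) :
    ∃ g, eLpNorm (h - g) 2 ν ≤ ε ∧ IsBlockFun g := by
  refine MemLp.induction_dense (by norm_num) IsBlockFun ?_ (fun f g hf hg => hf.map₂ hg (· + ·))
    (fun f hf => hf.measurable.aestronglyMeasurable) hh hε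
  intro c s hs _ ε hε
  obtain ⟨η, hη, hη'⟩ := exists_eLpNorm_indicator_le (μ := ν) (p := 2) (by norm_num) c hε
  -- Block sets form a ring that contains the whole space and generates the product σ-algebra, so
  -- they approximate `s` in measure.
  obtain ⟨t, ht, hts⟩ := exists_measure_symmDiff_lt_of_generateFrom_isSetRing (μ := ν)
    isSetRing_blockSets ⟨{Set.univ}, Set.countable_singleton _, by
      simpa [blockSets] using isBlockFun_const (S := S) (m := m) 1, by simp⟩
    generateFrom_blockSets hs (ε := η) (by exact_mod_cast hη)
  refine ⟨t.indicator fun _ => c, ?_, ?_⟩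
  · rw [show eLpNorm (t.indicator (fun _ => c) - s.indicator fun _ => c) 2 ν
      = eLpNorm ((symmDiff t s).indicator fun _ => c) 2 ν from ?_]
    · exact hη' _ hts.le
    · refine eLpNorm_congr_norm_ae (ae_of_all _ fun z => ?_)
      by_cases h1 : z ∈ t <;> by_cases h2 : z ∈ s <;> simp [Set.mem_symmDiff, h1, h2]
  · have := IsBlockFun.map₂ ht ht fun x _ => x * c
    refine (congrArg IsBlockFun ?_).mp this
    ext z
    by_cases h1 : z ∈ t <;> simp [h1]

end BlockFunctions

/-! ### Powers of the empirical law as averages over index tuples. -/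

section Empirical

variable {S : Type*} [MeasurableSpace S] {m n : ℕ}

/-- In pushforward form, powers of the empirical law become images of the uniform law on index
tuples. -/
lemma empiricalLaw_eq_map (z : Fin n → S) :
    empiricalLaw n z = ((n : ℝ≥0∞)⁻¹ • Measure.count).map z := by
  ext s hs
  rw [Measure.map_apply (measurable_of_countable z) hs]
  simp only [empiricalLaw, Measure.coe_smul, Measure.coe_finsetSum, Pi.smul_apply,
    Finset.sum_apply, smul_eq_mul]
  rw [← lintegral_indicator_one (μ := Measure.count) ((measurable_of_countable z) hs),
    lintegral_fintype]
  congr 1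
  refine Finset.sum_congr rfl fun i _ => ?_
  rw [Measure.dirac_apply' _ hs, Measure.count_singleton, mul_one]
  rfl

lemma isProbabilityMeasure_empiricalLaw (hn : n ≠ 0) (z : Fin n → S) :
    IsProbabilityMeasure (empiricalLaw n z) := by
  constructor
  simp [empiricalLaw, ENNReal.inv_mul_cancel, hn]

lemma empiricalLaw_apply {s : Set S} (hs : MeasurableSet s) (z : Fin n → S) :
    empiricalLaw n z s = ENNReal.ofReal ((∑ i, s.indicator (fun _ => (1 : ℝ)) (z i)) / n) := by
  rcases Nat.eq_zero_or_pos n with rfl | hn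
  · simp [empiricalLaw]
  have hn' : (0 : ℝ) < n := by exact_mod_cast hn
  rw [ENNReal.ofReal_div_of_pos hn', ENNReal.ofReal_natCast, ENNReal.div_eq_inv_mul,
    ENNReal.ofReal_sum_of_nonneg fun i _ => Set.indicator_nonneg (fun _ _ => zero_le_one) _]
  simp only [empiricalLaw, Measure.coe_smul, Measure.coe_finsetSum, Pi.smul_apply,
    Finset.sum_apply, smul_eq_mul]
  congr 1
  refine Finset.sum_congr rfl fun i _ => ?_
  rw [Measure.dirac_apply' _ hs]
  by_cases h : z i ∈ s <;> simp [h]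

/-- Integrals against powers of the empirical law are V-statistics. -/
lemma lintegral_pi_empiricalLaw (hn : n ≠ 0) (z : Fin n → S) {f : (Fin m → S) → ℝ≥0∞}
    (hf : Measurable f) :
    ∫⁻ x, f x ∂(Measure.pi fun _ : Fin m => empiricalLaw n z)
      = ((n : ℝ≥0∞)⁻¹) ^ m * ∑ i : Fin m → Fin n, f fun k => z (i k) := by
  have hz : Measurable z := measurable_of_countable z
  have : IsFiniteMeasure ((n : ℝ≥0∞)⁻¹ • (Measure.count : Measure (Fin n))) :=
    ⟨by simp [ENNReal.mul_lt_top_iff, hn, pos_iff_ne_zero]⟩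
  rw [empiricalLaw_eq_map, ← Measure.pi_map_pi (fun _ => hz.aemeasurable),
    lintegral_map hf (by fun_prop), lintegral_fintype, Finset.mul_sum]
  refine Finset.sum_congr rfl fun i _ => ?_
  rw [Measure.pi_singleton]
  simp [mul_comm]

lemma memLp_pi_empiricalLaw (hn : n ≠ 0) (z : Fin n → S) {h : (Fin m → S) → ℝ}
    (hh : Measurable h) : MemLp h 2 (Measure.pi fun _ : Fin m => empiricalLaw n z) := by
  rw [memLp_two_iff_lintegral hh, lintegral_pi_empiricalLaw hn z (hh.enorm.pow_const 2)]
  refine ENNReal.mul_lt_top ?_ ?_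
  · exact ENNReal.pow_lt_top (by simp [pos_iff_ne_zero, hn])
  · exact ENNReal.sum_lt_top.2 fun i _ => ENNReal.pow_lt_top enorm_lt_top

end Empirical

/-! ### U-statistics as reverse martingales, and Doob's inequality. -/

section ReverseMartingale

variable {S : Type*} {m : ℕ}

/-- The U-statistic (mean over injective index tuples) of the first `n` terms of a sequence. -/
noncomputable def uMean (f : (Fin m → S) → ℝ) (n : ℕ) (z : ℕ → S) : ℝ :=
  (∑ j : Fin m ↪ Fin n, f fun k => z (j k)) / (Fintype.card (Fin m ↪ Fin n) : ℝ)

lemma uMean_nonneg {f : (Fin m → S) → ℝ} (hf : ∀ x, 0 ≤ f x) (n : ℕ) (z : ℕ → S) :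
    0 ≤ uMean f n z :=
  div_nonneg (Finset.sum_nonneg fun _ _ => hf _) (Nat.cast_nonneg _)

lemma uMean_comp_perm (f : (Fin m → S) → ℝ) {n : ℕ} {σ : Equiv.Perm ℕ}
    (hσ : ∀ i, n ≤ i → σ i = i) (z : ℕ → S) : uMean f n (fun i => z (σ i)) = uMean f n z := by
  have hlt : ∀ i, σ i < n ↔ i < n := fun i => by
    constructor
    · intro h
      by_contra hi
      rw [hσ i (not_lt.1 hi)] at h
      exact hi h
    · intro h
      by_contra hi
      exact hi ((σ.injective (hσ _ (not_lt.1 hi))).symm ▸ h)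
  -- Since `σ` fixes all indices from `n` on, it restricts to the first `n`; composing with `τ`
  -- merely permutes the embeddings in the sum.
  let τ : Equiv.Perm (Fin n) :=
    (Fin.equivSubtype.trans (σ.subtypePerm hlt)).trans Fin.equivSubtype.symm
  unfold uMean
  congr 1
  exact Fintype.sum_equiv (Equiv.embeddingCongr (Equiv.refl _) τ) _ _ fun j => rfl

variable [MeasurableSpace S]

lemma measurable_uMean {f : (Fin m → S) → ℝ} (hf : Measurable f) (n : ℕ) :
    Measurable (uMean f n) := by
  unfold uMean
  refine Measurable.div_const (Finset.measurable_sum _ fun j _ => ?_) _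
  exact hf.comp (by fun_prop)

/-- The events that are invariant under permutations of the first `n` coordinates. -/
@[reducible] def exchangeable (S : Type*) [MeasurableSpace S] (n : ℕ) : MeasurableSpace (ℕ → S) where
  MeasurableSet' A := MeasurableSet A ∧ ∀ σ : Equiv.Perm ℕ, (∀ i, n ≤ i → σ i = i) →
    (fun z i => z (σ i)) ⁻¹' A = A
  measurableSet_empty := ⟨MeasurableSet.empty, fun _ _ => rfl⟩
  measurableSet_compl A hA := ⟨hA.1.compl, fun σ hσ => by rw [Set.preimage_compl, hA.2 σ hσ]⟩
  measurableSet_iUnion A hA := ⟨MeasurableSet.iUnion fun i => (hA i).1, fun σ hσ => by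
    rw [Set.preimage_iUnion]; exact Set.iUnion_congr fun i => (hA i).2 σ hσ⟩

lemma exchangeable_le (n : ℕ) : exchangeable S n ≤ MeasurableSpace.pi := fun _ hA => hA.1

lemma exchangeable_anti {n n' : ℕ} (h : n ≤ n') : exchangeable S n' ≤ exchangeable S n :=
  fun _ hA => ⟨hA.1, fun σ hσ => hA.2 σ fun i hi => hσ i (h.trans hi)⟩

lemma measurable_uMean_exchangeable {f : (Fin m → S) → ℝ} (hf : Measurable f) (n : ℕ) :
    Measurable[exchangeable S n] (uMean f n) := fun B hB =>
  ⟨measurable_uMean hf n hB, fun σ hσ => by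
    ext z; simp only [Set.mem_preimage, uMean_comp_perm f hσ]⟩

variable {F : Measure S} [IsProbabilityMeasure F]

lemma measurePreserving_infinitePi_comp {j : Fin m → ℕ} (hj : Function.Injective j) :
    MeasurePreserving (fun (z : ℕ → S) k => z (j k)) (Measure.infinitePi fun _ => F)
      (Measure.pi fun _ => F) := by
  refine ⟨by fun_prop, ?_⟩
  rw [← Measure.infinitePi_eq_pi]
  exact Measure.map_infinitePi_infinitePi_of_inj hj

/-- Some permutation of the first `n` indices carries `0, …, m - 1` to `j`. Extended by the
identity, it preserves both the infinite product law and `A`. -/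
lemma setIntegral_exchangeable {f : (Fin m → S) → ℝ} (hf : Measurable f) {n : ℕ} (hmn : m ≤ n)
    (j : Fin m ↪ Fin n) {A : Set (ℕ → S)} (hA : MeasurableSet[exchangeable S n] A) :
    ∫ z in A, f (fun k => z (j k)) ∂(Measure.infinitePi fun _ => F)
      = ∫ z in A, f (fun k : Fin m => z k) ∂(Measure.infinitePi fun _ => F) := by
  have hpre := Equiv.Perm.isMultiplyPretransitive (Fin n) m
  obtain ⟨σ, hσ⟩ := hpre.exists_smul_eq (Fin.castLEEmb hmn) j
  let σ' : Equiv.Perm ℕ := σ.extendDomain Fin.equivSubtype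
  have hσ' : ∀ i, n ≤ i → σ' i = i := fun i hi =>
    Equiv.Perm.extendDomain_apply_not_subtype _ _ (not_lt.2 hi)
  have hj : ∀ k : Fin m, σ' k = j k := fun k => by
    have h1 := Equiv.Perm.extendDomain_apply_image σ Fin.equivSubtype (Fin.castLEEmb hmn k)
    rw [← hσ]
    exact h1
  have hmap : (Measure.infinitePi fun _ : ℕ => F).map (fun z i => z (σ' i))
      = Measure.infinitePi fun _ : ℕ => F :=
    Measure.map_infinitePi_infinitePi_of_inj σ'.injective
  have hmeas : Measurable fun (z : ℕ → S) i => z (σ' i) := by fun_prop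
  have hfm : Measurable fun z : ℕ → S => f fun k : Fin m => z k := hf.comp (by fun_prop)
  conv_rhs => rw [← hmap]
  rw [setIntegral_map hA.1 hfm.aestronglyMeasurable hmeas.aemeasurable, hA.2 σ' hσ']
  simp_rw [hj]

variable {f : (Fin m → S) → ℝ}

lemma integrable_comp_injective (hint : Integrable f (Measure.pi fun _ => F)) {j : Fin m → ℕ}
    (hj : Function.Injective j) :
    Integrable (fun z : ℕ → S => f fun k => z (j k)) (Measure.infinitePi fun _ => F) :=
  (measurePreserving_infinitePi_comp hj).integrable_comp_of_integrable hint

lemma integrable_uMean (hint : Integrable f (Measure.pi fun _ => F)) (n : ℕ) :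
    Integrable (uMean f n) (Measure.infinitePi fun _ => F) :=
  (integrable_finsetSum _ fun j _ => integrable_comp_injective hint
    (Fin.val_injective.comp j.injective)).div_const _

lemma setIntegral_uMean (hf : Measurable f) (hint : Integrable f (Measure.pi fun _ => F)) {n : ℕ}
    (hmn : m ≤ n) {A : Set (ℕ → S)} (hA : MeasurableSet[exchangeable S n] A) :
    ∫ z in A, uMean f n z ∂(Measure.infinitePi fun _ => F)
      = ∫ z in A, f (fun k : Fin m => z k) ∂(Measure.infinitePi fun _ => F) := by
  have hne : Nonempty (Fin m ↪ Fin n) := ⟨Fin.castLEEmb hmn⟩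
  have hc : (Fintype.card (Fin m ↪ Fin n) : ℝ) ≠ 0 := by exact_mod_cast Fintype.card_ne_zero
  unfold uMean
  have hi : ∀ j : Fin m ↪ Fin n, Integrable (fun z : ℕ → S => f fun k => z ((j k : Fin n) : ℕ))
      ((Measure.infinitePi fun _ => F).restrict A) := fun j =>
    (integrable_comp_injective hint (Fin.val_injective.comp j.injective)).integrableOn
  rw [integral_div, integral_finsetSum _ fun j _ => hi j]
  have : ∀ j : Fin m ↪ Fin n, ∫ z in A, f (fun k => z ((j k : Fin n) : ℕ))
      ∂(Measure.infinitePi fun _ => F) = _ := fun j => setIntegral_exchangeable hf hmn j hA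
  simp_rw [this]
  rw [Finset.sum_const, Finset.card_univ, nsmul_eq_mul, mul_div_cancel_left₀ _ hc]

/-- U-statistics are conditional expectations with respect to the exchangeable events. -/
lemma uMean_ae_eq_condExp (hf : Measurable f) (hint : Integrable f (Measure.pi fun _ => F))
    {n : ℕ} (hmn : m ≤ n) :
    uMean f n =ᵐ[Measure.infinitePi fun _ => F]
      (Measure.infinitePi fun _ => F)[fun z : ℕ → S => f fun k : Fin m => z k |
        exchangeable S n] := by
  refine ae_eq_condExp_of_forall_setIntegral_eq (exchangeable_le n)
    (integrable_comp_injective hint Fin.val_injective)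
    (fun A _ _ => (integrable_uMean hint n).integrableOn)
    (fun A hA _ => setIntegral_uMean hf hint hmn hA) ?_
  exact (measurable_uMean_exchangeable hf n).stronglyMeasurable.aestronglyMeasurable

/-- The exchangeable events, in reversed order from a finite horizon. -/
def exchangeableFiltration (S : Type*) [MeasurableSpace S] (m N : ℕ) :
    Filtration ℕ (MeasurableSpace.pi : MeasurableSpace (ℕ → S)) where
  -- Time `k` stands for sample size `m + (N - k)`: the size falls from `m + N` to `m`, and
  -- truncated subtraction then keeps it at `m`.
  seq k := exchangeable S (m + (N - k))
  mono' _ _ h := exchangeable_anti (by omega)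
  le' _ := exchangeable_le _

/-- All these U-statistics are conditional expectations of one variable, so the tower property
applies. -/
lemma martingale_uMean (hf : Measurable f) (hint : Integrable f (Measure.pi fun _ => F)) (N : ℕ) :
    Martingale (fun k => uMean f (m + (N - k))) (exchangeableFiltration S m N)
      (Measure.infinitePi fun _ => F) := by
  refine ⟨fun k => (measurable_uMean_exchangeable hf _).stronglyMeasurable, fun i j hij => ?_⟩
  refine (condExp_congr_ae (uMean_ae_eq_condExp hf hint (Nat.le_add_right _ _))).trans ?_
  refine (condExp_condExp_of_le ((exchangeableFiltration S m N).mono hij)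
    (exchangeable_le _)).trans ?_
  exact (uMean_ae_eq_condExp hf hint (Nat.le_add_right _ _)).symm

lemma integral_uMean (hf : Measurable f) (hint : Integrable f (Measure.pi fun _ => F)) {n : ℕ}
    (hmn : m ≤ n) :
    ∫ z, uMean f n z ∂(Measure.infinitePi fun _ => F) = ∫ x, f x ∂(Measure.pi fun _ => F) := by
  have h := setIntegral_uMean hf hint hmn (A := Set.univ) MeasurableSet.univ
  simp only [setIntegral_univ] at h
  have hmp := measurePreserving_infinitePi_comp (F := F) (j := fun k : Fin m => (k : ℕ))
    Fin.val_injective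
  rw [h, ← hmp.map_eq, integral_map hmp.measurable.aemeasurable hf.aestronglyMeasurable]

/-- Maximal inequality for U-statistics of a nonnegative kernel. -/
lemma maximal_uMean (hf : Measurable f) (h0 : ∀ x, 0 ≤ f x)
    (hint : Integrable f (Measure.pi fun _ => F)) (ε : NNReal) :
    ε * (Measure.infinitePi fun _ => F) {z | ∃ n, m ≤ n ∧ (ε : ℝ) ≤ uMean f n z}
      ≤ ENNReal.ofReal (∫ x, f x ∂(Measure.pi fun _ => F)) := by
  set Q := Measure.infinitePi fun _ : ℕ => F
  -- Time can be reversed only from a finite horizon; the bound does not depend on `N`, so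
  -- continuity from below finishes.
  let E : ℕ → Set (ℕ → S) := fun N => {z | ∃ n, m ≤ n ∧ n ≤ m + N ∧ (ε : ℝ) ≤ uMean f n z}
  have hE : {z | ∃ n, m ≤ n ∧ (ε : ℝ) ≤ uMean f n z} = ⋃ N, E N := by
    ext z
    simp only [E, Set.mem_iUnion, Set.mem_ofPred_eq]
    constructor
    · rintro ⟨n, h1, h2⟩
      exact ⟨n, n, h1, by omega, h2⟩
    · rintro ⟨N, n, h1, _, h2⟩
      exact ⟨n, h1, h2⟩
  have hmono : Monotone E := fun N N' h z ⟨n, h1, h2, h3⟩ => ⟨n, h1, by omega, h3⟩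
  rw [hE, hmono.measure_iUnion, ENNReal.mul_iSup]
  refine iSup_le fun N => ?_
  have hmax := maximal_ineq (martingale_uMean hf hint N).submartingale
    (fun k z => uMean_nonneg h0 _ z) (ε := ε) N
  refine (le_trans ?_ hmax).trans ?_
  · gcongr
    rintro z ⟨n, h1, h2, h3⟩
    simp only [Set.mem_ofPred_eq, Finset.le_sup'_iff, Finset.mem_range]
    exact ⟨N - (n - m), by omega, by rwa [show m + (N - (N - (n - m))) = n by omega]⟩
  · refine ENNReal.ofReal_le_ofReal ?_
    rw [← integral_uMean hf hint (n := m + (N - N)) (Nat.le_add_right _ _)]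
    exact setIntegral_le_integral (integrable_uMean hint _)
      (ae_of_all _ fun z => uMean_nonneg h0 _ z)

/-- An unbounded path exceeds every threshold `K`, an event whose probability the maximal inequality
makes arbitrarily small. -/
lemma ae_bounded_uMean (hf : Measurable f) (h0 : ∀ x, 0 ≤ f x)
    (hint : Integrable f (Measure.pi fun _ => F)) :
    ∀ᵐ z ∂(Measure.infinitePi fun _ : ℕ => F), ∃ B : ℝ, ∀ n, m ≤ n → uMean f n z ≤ B := by
  set I := ENNReal.ofReal (∫ x, f x ∂(Measure.pi fun _ => F))
  rw [ae_iff]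
  refine le_antisymm (ENNReal.le_of_forall_pos_le_add fun δ hδ _ => ?_) zero_le
  rw [zero_add]
  have hI : I ≠ ∞ := ENNReal.ofReal_ne_top
  obtain ⟨K, hK⟩ := ENNReal.exists_nat_mul_gt (a := δ) (b := I) (by exact_mod_cast hδ.ne') hI
  have hK0 : (K : ℝ≥0∞) ≠ 0 := by rintro h; simp [h] at hK
  have hsub : {z : ℕ → S | ¬ ∃ B : ℝ, ∀ n, m ≤ n → uMean f n z ≤ B}
      ⊆ {z | ∃ n, m ≤ n ∧ ((K : NNReal) : ℝ) ≤ uMean f n z} := by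
    intro z hz
    simp only [Set.mem_ofPred_eq, not_exists, not_forall, not_le] at hz
    obtain ⟨n, hn, h⟩ := hz K
    exact ⟨n, hn, by simpa using h.le⟩
  refine (measure_mono hsub).trans ?_
  have h1 := (maximal_uMean hf h0 hint (K : NNReal)).trans hK.le
  simp only [ENNReal.coe_natCast] at h1
  exact (ENNReal.mul_le_mul_iff_right hK0 (ENNReal.natCast_ne_top K)).1 h1

end ReverseMartingale

/-! ### Control of V-statistics by U-statistics of contracted kernels. -/

section VStatistics

variable {S : Type*} {m : ℕ}

/-- The V-statistic (mean over all index tuples) of the first `n` terms of a sequence. -/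
noncomputable def vMean (f : (Fin m → S) → ℝ) (n : ℕ) (z : ℕ → S) : ℝ :=
  (∑ i : Fin m → Fin n, f fun k => z (i k)) / (n : ℝ) ^ m

/-- A non-injective index tuple factors in many ways through a non-injective pattern. -/
lemma card_factorizations {n : ℕ} (hmn : m < n) {i : Fin m → Fin n} (hi : ¬ Function.Injective i) :
    n - m ≤ (Finset.univ.filter fun p : {τ : Fin m → Fin m // ¬ Function.Injective τ} ×
      (Fin m ↪ Fin n) => (fun k => p.2 (p.1.1 k)) = i).card := by
  classical
  have hcard : (Finset.univ.image i).card ≤ m := by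
    simpa using Finset.card_image_le (s := (Finset.univ : Finset (Fin m))) (f := i)
  -- Enlarge the range of `i` to a set `R` of exactly `m` indices; labelling `R` by `Fin m` turns
  -- `i` into a pattern `τ`.
  obtain ⟨R, hR, hRm⟩ := Finset.exists_superset_card_eq hcard (by simpa using hmn.le)
  have hiR : ∀ k, i k ∈ R := fun k => hR (Finset.mem_image_of_mem i (Finset.mem_univ k))
  let e : R ≃ Fin m := R.equivFinOfCardEq hRm
  let τ : Fin m → Fin m := fun k => e ⟨i k, hiR k⟩
  have hτ : ¬ Function.Injective τ := fun h => hi fun a b hab => h (by simp [τ, hab])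
  have hsurj : ¬ Function.Surjective τ := fun h => hτ (Finite.injective_iff_surjective.2 h)
  obtain ⟨t, ht⟩ : ∃ t, ∀ k, τ k ≠ t := by simpa [Function.Surjective] using hsurj
  let j : Fin m → Fin n := fun k => (e.symm k : Fin n)
  have hj : Function.Injective j := Subtype.val_injective.comp e.symm.injective
  have hjR : ∀ k, j k ∈ R := fun k => (e.symm k).2
  -- The pattern misses the slot `t`, so any of the `n - m` indices outside `R` may fill it without
  -- changing the composite.
  have hupd : ∀ s : {s // s ∉ R}, Function.Injective (Function.update j t s.1) := by
    rintro ⟨s, hs⟩ a b hab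
    by_cases ha : a = t <;> by_cases hb : b = t
    · rw [ha, hb]
    · subst ha
      rw [Function.update_self, Function.update_of_ne hb] at hab
      exact absurd (by rw [show s = j b from hab]; exact hjR b) hs
    · subst hb
      rw [Function.update_self, Function.update_of_ne ha] at hab
      exact absurd (by rw [← show j a = s from hab]; exact hjR a) hs
    · rw [Function.update_of_ne ha, Function.update_of_ne hb] at hab
      exact hj hab
  have hc : Fintype.card {s // s ∉ R} = n - m := by
    rw [Fintype.card_subtype_compl, Fintype.card_fin, Fintype.card_coe, hRm]
  rw [← hc, ← Finset.card_univ]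
  refine Finset.card_le_card_of_injOn (fun s => (⟨τ, hτ⟩, ⟨_, hupd s⟩)) (fun s _ => ?_)
    fun s _ s' _ hss => ?_
  · simp only [Finset.coe_filter, Finset.mem_univ, true_and, Set.mem_ofPred_eq]
    funext k
    change Function.update j t s.1 (τ k) = i k
    rw [Function.update_of_ne (ht k)]
    simp [j, τ]
  · have h1 := congrArg (fun p : {τ : Fin m → Fin m // ¬ Function.Injective τ} ×
      (Fin m ↪ Fin n) => p.2 t) hss
    change Function.update j t s.1 t = Function.update j t s'.1 t at h1
    rw [Function.update_self, Function.update_self] at h1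
    exact Subtype.ext h1

lemma card_embedding_le_pow (n : ℕ) : (Fintype.card (Fin m ↪ Fin n) : ℝ) ≤ (n : ℝ) ^ m := by
  have := Fintype.card_le_of_injective (fun j : Fin m ↪ Fin n => (j : Fin m → Fin n))
    DFunLike.coe_injective
  simp only [Fintype.card_fun, Fintype.card_fin] at this
  exact_mod_cast this

lemma sum_embedding_le (f : (Fin m → S) → ℝ) (h0 : ∀ x, 0 ≤ f x) (n : ℕ) (z : ℕ → S) :
    ∑ j : Fin m ↪ Fin n, f (fun k => z (j k)) ≤ (n : ℝ) ^ m * uMean f n z := by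
  rcases isEmpty_or_nonempty (Fin m ↪ Fin n) with h | h
  · simp [uMean]
  · have hc : (Fintype.card (Fin m ↪ Fin n) : ℝ) ≠ 0 := by exact_mod_cast Fintype.card_ne_zero
    calc _ = (Fintype.card (Fin m ↪ Fin n) : ℝ) * uMean f n z := by
          unfold uMean; field_simp
      _ ≤ _ := mul_le_mul_of_nonneg_right (card_embedding_le_pow n) (uMean_nonneg h0 n z)

open scoped Classical in
/-- V-statistics are dominated by the U-statistics of the kernel and its contractions. -/
lemma vMean_le {f : (Fin m → S) → ℝ} (h0 : ∀ x, 0 ≤ f x) {n : ℕ} (hmn : m < n) (z : ℕ → S) :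
    vMean f n z ≤ uMean f n z + (∑ τ : {τ : Fin m → Fin m // ¬ Function.Injective τ},
      uMean (fun x => f fun k => x (τ.1 k)) n z) / ((n : ℝ) - m) := by
  have hn : (0 : ℝ) < (n : ℝ) ^ m := by
    have : (0 : ℝ) < n := by exact_mod_cast (Nat.zero_le m).trans_lt hmn
    positivity
  have hnm : (0 : ℝ) < (n : ℝ) - m := sub_pos.2 (by exact_mod_cast hmn)
  have hsplit : ∑ i : Fin m → Fin n, f (fun k => z (i k))
      = ∑ i with Function.Injective i, f (fun k => z ((i k : Fin n) : ℕ))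
        + ∑ i with ¬ Function.Injective i, f (fun k => z ((i k : Fin n) : ℕ)) :=
    (Finset.sum_filter_add_sum_filter_not _ _ _).symm
  have hinj : ∑ i with Function.Injective i, f (fun k => z ((i k : Fin n) : ℕ))
      = ∑ j : Fin m ↪ Fin n, f (fun k => z (j k)) := by
    rw [← Finset.sum_subtype_eq_sum_filter, Finset.subtype_univ]
    exact Fintype.sum_equiv (Equiv.subtypeInjectiveEquivEmbedding (Fin m) (Fin n)) _ _
      fun i => rfl
  -- Double counting: each non-injective `i` has at least `n - m` factorizations, so its term occurs
  -- at least that often in the sum over all pairs of a pattern and an embedding.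
  have hnon : ((n : ℝ) - m) * ∑ i with ¬ Function.Injective i, f (fun k => z ((i k : Fin n) : ℕ))
      ≤ (n : ℝ) ^ m * ∑ τ : {τ : Fin m → Fin m // ¬ Function.Injective τ},
        uMean (fun x => f fun k => x (τ.1 k)) n z := by
    calc ((n : ℝ) - m) * ∑ i with ¬ Function.Injective i, f (fun k => z ((i k : Fin n) : ℕ))
        ≤ ∑ i : Fin m → Fin n, ∑ p : {τ : Fin m → Fin m // ¬ Function.Injective τ} ×
            (Fin m ↪ Fin n) with (fun k => p.2 (p.1.1 k)) = i,
              f (fun k => z (p.2 (p.1.1 k))) := by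
          rw [Finset.mul_sum]
          refine (Finset.sum_le_sum fun i hi => ?_).trans
            (Finset.sum_le_univ_sum_of_nonneg (s := {i | ¬ Function.Injective i})
              fun i => Finset.sum_nonneg fun _ _ => h0 _)
          have hi' : ¬ Function.Injective i := (Finset.mem_filter.1 hi).2
          calc ((n : ℝ) - m) * f (fun k => z ((i k : Fin n) : ℕ))
              ≤ ((Finset.univ.filter fun p : {τ : Fin m → Fin m // ¬ Function.Injective τ} ×
                (Fin m ↪ Fin n) => (fun k => p.2 (p.1.1 k)) = i).card : ℝ)
                  * f (fun k => z ((i k : Fin n) : ℕ)) := by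
                refine mul_le_mul_of_nonneg_right ?_ (h0 _)
                rw [← Nat.cast_sub hmn.le]
                exact_mod_cast card_factorizations hmn hi'
            _ = ∑ p : {τ : Fin m → Fin m // ¬ Function.Injective τ} ×
                (Fin m ↪ Fin n) with (fun k => p.2 (p.1.1 k)) = i,
                  f (fun k => z (p.2 (p.1.1 k))) := by
                rw [← nsmul_eq_mul, ← Finset.sum_const]
                refine Finset.sum_congr rfl fun p hp => ?_
                rw [← (Finset.mem_filter.1 hp).2]
      _ = ∑ p : {τ : Fin m → Fin m // ¬ Function.Injective τ} × (Fin m ↪ Fin n),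
            f (fun k => z (p.2 (p.1.1 k))) :=
          Finset.sum_fiberwise _ (fun p : {τ : Fin m → Fin m // ¬ Function.Injective τ} ×
            (Fin m ↪ Fin n) => fun k => p.2 (p.1.1 k)) _
      _ = ∑ τ : {τ : Fin m → Fin m // ¬ Function.Injective τ}, ∑ j : Fin m ↪ Fin n,
            f (fun k => z (j (τ.1 k))) := Fintype.sum_prod_type _
      _ ≤ _ := by
          rw [Finset.mul_sum]
          exact Finset.sum_le_sum fun τ _ =>
            sum_embedding_le (fun x => f fun k => x (τ.1 k)) (fun _ => h0 _) n z
  unfold vMean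
  rw [div_le_iff₀ hn, hsplit, hinj, add_mul]
  refine add_le_add ?_ ?_
  · rw [mul_comm]; exact sum_embedding_le f h0 n z
  · rw [div_mul_eq_mul_div, le_div_iff₀ hnm, mul_comm, mul_comm (∑ τ, _)]
    exact hnon

variable [MeasurableSpace S] {F : Measure S} [IsProbabilityMeasure F]

/-- One half of the strong law for V-statistics, with an explicit exceptional probability. -/
lemma measure_not_eventually_vMean_le {f : (Fin m → S) → ℝ} (hf : Measurable f)
    (h0 : ∀ x, 0 ≤ f x)
    (hint : ∀ τ : Fin m → Fin m, Integrable (fun x => f fun k => x (τ k))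
      (Measure.pi fun _ => F)) {ε : NNReal} (hε : 0 < ε) :
    ε * (Measure.infinitePi fun _ : ℕ => F) {z | ¬ ∀ᶠ n in atTop, vMean f n z ≤ 2 * ε}
      ≤ ENNReal.ofReal (∫ x, f x ∂(Measure.pi fun _ => F)) := by
  classical
  set Q := Measure.infinitePi fun _ : ℕ => F
  have hb : ∀ᵐ z ∂Q, ∀ τ : Fin m → Fin m, ∃ B : ℝ, ∀ n, m ≤ n →
      uMean (fun x => f fun k => x (τ k)) n z ≤ B :=
    ae_all_iff.2 fun τ => ae_bounded_uMean (hf.comp (by fun_prop)) (fun _ => h0 _) (hint τ)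
  refine le_trans ?_ (maximal_uMean hf h0 (hint id) ε)
  refine mul_le_mul' le_rfl (measure_mono_ae ?_)
  filter_upwards [hb] with z hz hbad
  by_contra hgood
  apply hbad
  change ¬ ∃ n, m ≤ n ∧ (ε : ℝ) ≤ uMean f n z at hgood
  push Not at hgood
  choose B hB using hz
  -- Boundedness of the contracted U-statistics suffices, as the divisor `n - m` grows.
  have hlim : Tendsto (fun n : ℕ => (∑ τ : {τ : Fin m → Fin m // ¬ Function.Injective τ}, B τ.1)
      / ((n : ℝ) - m)) atTop (𝓝 0) :=
    tendsto_const_nhds.div_atTop (tendsto_atTop_add_const_right _ _ tendsto_natCast_atTop_atTop)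
  filter_upwards [hlim.eventually_lt_const (show (0 : ℝ) < ε from hε), eventually_gt_atTop m]
    with n hn hmn
  have hnm : (0 : ℝ) < (n : ℝ) - m := sub_pos.2 (by exact_mod_cast hmn)
  calc vMean f n z ≤ _ := vMean_le h0 hmn z
    _ ≤ ε + (∑ τ : {τ : Fin m → Fin m // ¬ Function.Injective τ}, B τ.1) / ((n : ℝ) - m) := by
        gcongr
        · exact (hgood n hmn.le).le
        · exact hB _ n hmn.le
    _ ≤ 2 * ε := by linarith

end VStatistics

/-! ### Combination of the coupling bound with the almost sure estimates. -/

section Consistency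

variable {S : Type*} [MeasurableSpace S] {m : ℕ}

lemma enorm_sub_sq_le_three (a b c d : ℝ) :
    ‖a - b‖ₑ ^ 2 ≤ 3 * (‖a - c‖ₑ ^ 2 + ‖b - d‖ₑ ^ 2 + ‖c - d‖ₑ ^ 2) := by
  have h (x : ℝ) : ‖x‖ₑ ^ 2 = ENNReal.ofReal (x ^ 2) := by
    rw [← ofReal_norm, ← ENNReal.ofReal_pow (norm_nonneg _), Real.norm_eq_abs, sq_abs]
  have h3 : (3 : ℝ≥0∞) = ENNReal.ofReal 3 := by norm_num
  simp_rw [h]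
  rw [h3, ← ENNReal.ofReal_add (by positivity) (by positivity),
    ← ENNReal.ofReal_add (by positivity) (by positivity), ← ENNReal.ofReal_mul (by norm_num)]
  refine ENNReal.ofReal_le_ofReal ?_
  nlinarith [sq_nonneg (a - c + (b - d)), sq_nonneg (a - c - (c - d)), sq_nonneg (b - d + (c - d))]

/-- The difference vanishes unless some coordinate has disagreeing labels, and is at most `2 * C`
otherwise; the factor `m` is a union bound. -/
lemma lintegral_diffKernel_block_le {ι : Type*} [Fintype ι] [MeasurableSpace ι]
    [MeasurableSingletonClass ι] {b : S → ι} (hb : Measurable b) (g₀ : (Fin m → ι) → ℝ) {C : ℝ}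
    (hC : ∀ w, |g₀ w| ≤ C) (π : Measure (S × S)) [IsProbabilityMeasure π] :
    ∫⁻ w, ‖diffKernel (fun z => g₀ fun k => b (z k)) w‖ₑ ^ 2 ∂(Measure.pi fun _ : Fin m => π)
      ≤ ENNReal.ofReal ((2 * C) ^ 2) * (m * π {x | b x.1 ≠ b x.2}) := by
  let E : Set (Fin m → S × S) := ⋃ k, (fun w => w k) ⁻¹' {x | b x.1 ≠ b x.2}
  have hmeas : MeasurableSet {x : S × S | b x.1 ≠ b x.2} :=
    (measurableSet_eq_fun (hb.comp measurable_fst) (hb.comp measurable_snd)).compl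
  have hE : (Measure.pi fun _ : Fin m => π) E ≤ m * π {x | b x.1 ≠ b x.2} := by
    refine (measure_iUnion_fintype_le _ _).trans (le_of_eq ?_)
    have : ∀ k : Fin m, (Measure.pi fun _ : Fin m => π) ((fun w => w k) ⁻¹' {x | b x.1 ≠ b x.2})
        = π {x | b x.1 ≠ b x.2} := fun k =>
      (measurePreserving_eval (fun _ : Fin m => π) k).measure_preimage hmeas.nullMeasurableSet
    simp_rw [this]
    simp
  calc _ ≤ ∫⁻ w, E.indicator (fun _ => ENNReal.ofReal ((2 * C) ^ 2)) w
        ∂(Measure.pi fun _ : Fin m => π) := by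
        refine lintegral_mono fun w => ?_
        by_cases hw : w ∈ E
        · rw [Set.indicator_of_mem hw, ← ofReal_norm, ← ENNReal.ofReal_pow (norm_nonneg _)]
          refine ENNReal.ofReal_le_ofReal (pow_le_pow_left₀ (norm_nonneg _) ?_ 2)
          refine (norm_sub_le _ _).trans ?_
          rw [two_mul]
          exact add_le_add (hC _) (hC _)
        · have hlab : ∀ k, b (w k).1 = b (w k).2 := by
            simpa [E] using hw
          simp [diffKernel, hlab]
    _ ≤ ENNReal.ofReal ((2 * C) ^ 2) * (Measure.pi fun _ : Fin m => π) E :=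
        lintegral_indicator_const_le _ _
    _ ≤ _ := by gcongr

/-- Two laws that nearly agree on the blocks of a good approximation of the kernel lead to nearby
laws of the degenerate statistic. -/
lemma d2_uStat_le_of_block (hm : 2 ≤ m) {h : (Fin m → S) → ℝ} (hh : Measurable h)
    {G F : Measure S} [IsProbabilityMeasure G] [IsProbabilityMeasure F]
    (h1 : MemLp h 2 (Measure.pi fun _ => G)) (h2 : MemLp h 2 (Measure.pi fun _ => F))
    {ι : Type*} [Fintype ι] [MeasurableSpace ι]
    [MeasurableSingletonClass ι] {b : S → ι} (hb : Measurable b) (g₀ : (Fin m → ι) → ℝ) {C : ℝ}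
    (hC : ∀ w, |g₀ w| ≤ C) (n : ℕ) :
    d2 ((Measure.pi fun _ : Fin n => G).map (uStat h G n))
      ((Measure.pi fun _ : Fin n => F).map (uStat h F n))
      ≤ (96 * ((∫⁻ z, ‖h z - g₀ fun k => b (z k)‖ₑ ^ 2 ∂(Measure.pi fun _ : Fin m => G))
        + (∫⁻ z, ‖h z - g₀ fun k => b (z k)‖ₑ ^ 2 ∂(Measure.pi fun _ : Fin m => F))
        + ENNReal.ofReal ((2 * C) ^ 2) *
          (m * ∑ i, (G (b ⁻¹' {i}) - F (b ⁻¹' {i}))))) ^ (1 / 2 : ℝ) := by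
  obtain ⟨π, _, hG, hF, hπ⟩ := exists_block_coupling G F hb
  refine (d2_uStat_le hm hh hG hF h1 h2 n).trans ?_
  refine ENNReal.rpow_le_rpow ?_ (by norm_num)
  rw [show (96 : ℝ≥0∞) = 32 * 3 by norm_num, mul_assoc]
  refine mul_le_mul' le_rfl ?_
  have hg : Measurable fun z : Fin m → S => g₀ fun k => b (z k) :=
    (measurable_of_countable g₀).comp (by fun_prop)
  have hd : Measurable fun z : Fin m → S => ‖h z - g₀ fun k => b (z k)‖ₑ ^ 2 :=
    (hh.sub hg).enorm.pow_const 2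
  have hG' := measurePreserving_pi_comp (ι := Fin m) hG
  have hF' := measurePreserving_pi_comp (ι := Fin m) hF
  calc ∫⁻ w, ‖diffKernel h w‖ₑ ^ 2 ∂(Measure.pi fun _ : Fin m => π)
      ≤ ∫⁻ w : Fin m → S × S, 3 * (‖h (fun k => (w k).1) - g₀ fun k => b (w k).1‖ₑ ^ 2
          + ‖h (fun k => (w k).2) - g₀ fun k => b (w k).2‖ₑ ^ 2
          + ‖diffKernel (fun z => g₀ fun k => b (z k)) w‖ₑ ^ 2)
          ∂(Measure.pi fun _ : Fin m => π) :=
        lintegral_mono fun w => enorm_sub_sq_le_three _ _ _ _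
    _ = 3 * ((∫⁻ z, ‖h z - g₀ fun k => b (z k)‖ₑ ^ 2 ∂(Measure.pi fun _ : Fin m => G))
        + (∫⁻ z, ‖h z - g₀ fun k => b (z k)‖ₑ ^ 2 ∂(Measure.pi fun _ : Fin m => F))
        + ∫⁻ w, ‖diffKernel (fun z => g₀ fun k => b (z k)) w‖ₑ ^ 2
          ∂(Measure.pi fun _ : Fin m => π)) := by
        have hdF : Measurable fun w : Fin m → S × S =>
            ‖h (fun k => (w k).2) - g₀ fun k => b (w k).2‖ₑ ^ 2 := hd.comp hF'.measurable
        rw [lintegral_const_mul' _ _ (by norm_num),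
          lintegral_add_right _ ((measurable_diffKernel hg).enorm.pow_const 2),
          lintegral_add_right _ hdF, ← hG'.lintegral_comp hd,
          ← hF'.lintegral_comp hd]
    _ ≤ _ := by
        gcongr
        refine (lintegral_diffKernel_block_le hb g₀ hC π).trans ?_
        gcongr

lemma lintegral_pi_empiricalLaw_eq_vMean {n : ℕ} (hn : n ≠ 0) (z : ℕ → S)
    {f : (Fin m → S) → ℝ} (hf : Measurable f) :
    ∫⁻ x, ‖f x‖ₑ ^ 2 ∂(Measure.pi fun _ : Fin m => empiricalLaw n fun i : Fin n => z i)
      = ENNReal.ofReal (vMean (fun x => f x ^ 2) n z) := by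
  have hn' : (0 : ℝ) < (n : ℝ) ^ m := by
    have : (0 : ℝ) < n := by exact_mod_cast Nat.pos_of_ne_zero hn
    positivity
  rw [lintegral_pi_empiricalLaw hn _ (hf.enorm.pow_const 2), vMean, ENNReal.ofReal_div_of_pos hn',
    ENNReal.ofReal_pow (Nat.cast_nonneg n), ENNReal.ofReal_natCast, ENNReal.div_eq_inv_mul,
    ENNReal.inv_pow, ENNReal.ofReal_sum_of_nonneg fun _ _ => sq_nonneg _]
  congr 1
  refine Finset.sum_congr rfl fun i _ => ?_
  rw [← ofReal_norm, ← ENNReal.ofReal_pow (norm_nonneg _), Real.norm_eq_abs, sq_abs]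

variable {F : Measure S} [IsProbabilityMeasure F]

lemma ae_tendsto_empiricalLaw {A : Set S} (hA : MeasurableSet A) :
    ∀ᵐ z ∂(Measure.infinitePi fun _ : ℕ => F),
      Tendsto (fun n => empiricalLaw n (fun i : Fin n => z i) A) atTop (𝓝 (F A)) := by
  set Q := Measure.infinitePi fun _ : ℕ => F
  have hφ : Measurable (A.indicator fun _ => (1 : ℝ)) := measurable_const.indicator hA
  let X : ℕ → (ℕ → S) → ℝ := fun j z => A.indicator (fun _ => (1 : ℝ)) (z j)
  have hX : ∀ j, Measurable (X j) := fun j => hφ.comp (measurable_pi_apply j)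
  have hev : ∀ j : ℕ, MeasurePreserving (fun z : ℕ → S => z j) Q F := fun j =>
    measurePreserving_eval_infinitePi (fun _ : ℕ => F) j
  have hintA : Integrable (A.indicator fun _ => (1 : ℝ)) F := (integrable_const 1).indicator hA
  have hind : iIndepFun X Q := iIndepFun_infinitePi (P := fun _ : ℕ => F)
    (X := fun _ => A.indicator fun _ => (1 : ℝ)) fun _ => hφ
  have hlaw : ∀ j, Q.map (X j) = F.map (A.indicator fun _ => (1 : ℝ)) := fun j => by
    rw [← (hev j).map_eq, Measure.map_map hφ (measurable_pi_apply j)]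
    rfl
  have hmean : ∫ z, X 0 z ∂Q = F.real A := by
    rw [← integral_indicator_one hA, ← (hev 0).map_eq,
      integral_map (hev 0).measurable.aemeasurable (by
        exact (measurable_const.indicator hA).aestronglyMeasurable)]
    rfl
  filter_upwards [strong_law_ae_real X ((hev 0).integrable_comp_of_integrable hintA)
    (fun i j hij => hind.indepFun hij)
    fun i => ⟨(hX i).aemeasurable, (hX 0).aemeasurable, by rw [hlaw, hlaw]⟩] with z hz
  rw [hmean] at hz
  have h2 := (ENNReal.continuous_ofReal.tendsto _).comp hz
  rw [ofReal_measureReal] at h2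
  refine h2.congr fun n => ?_
  simp only [Function.comp_apply, X]
  rw [empiricalLaw_apply hA, Finset.sum_range]

lemma ae_tendsto_sum_block {ι : Type*} [Fintype ι] [MeasurableSpace ι]
    [MeasurableSingletonClass ι] {b : S → ι} (hb : Measurable b) (c : ℝ≥0∞) (hc : c ≠ ∞) :
    ∀ᵐ z ∂(Measure.infinitePi fun _ : ℕ => F),
      Tendsto (fun n => c * (m * ∑ i, (empiricalLaw n (fun i : Fin n => z i) (b ⁻¹' {i})
        - F (b ⁻¹' {i})))) atTop (𝓝 0) := by
  have hall : ∀ᵐ z ∂(Measure.infinitePi fun _ : ℕ => F), ∀ i : ι,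
      Tendsto (fun n => empiricalLaw n (fun i : Fin n => z i) (b ⁻¹' {i})) atTop
        (𝓝 (F (b ⁻¹' {i}))) :=
    ae_all_iff.2 fun i => ae_tendsto_empiricalLaw (hb (measurableSet_singleton i))
  filter_upwards [hall] with z hz
  have hsum : Tendsto (fun n => ∑ i, (empiricalLaw n (fun i : Fin n => z i) (b ⁻¹' {i})
      - F (b ⁻¹' {i}))) atTop (𝓝 (∑ i : ι, (F (b ⁻¹' {i}) - F (b ⁻¹' {i})))) :=
    tendsto_finsetSum _ fun i _ => ENNReal.Tendsto.sub (hz i) tendsto_const_nhds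
      (Or.inl (measure_ne_top _ _))
  simp only [tsub_self, Finset.sum_const_zero] at hsum
  have h1 := ENNReal.Tendsto.const_mul (a := (m : ℝ≥0∞)) hsum (Or.inr (ENNReal.natCast_ne_top m))
  have h2 := ENNReal.Tendsto.const_mul (a := c) h1 (Or.inr hc)
  simpa using h2

/-- The block approximation may depend on `δ`, the allowed probability of failure, because the bound
in terms of `ε` does not mention it. -/
lemma ae_eventually_d2_le (hm : 2 ≤ m) {h : (Fin m → S) → ℝ} (hh : Measurable h)
    (hpat : ∀ τ : Fin m → Fin m, MemLp (fun x : Fin m → S => h fun k => x (τ k)) 2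
      (Measure.pi fun _ => F)) {ε : NNReal} (hε : 0 < ε) :
    ∀ᵐ z ∂(Measure.infinitePi fun _ : ℕ => F), ∀ᶠ n : ℕ in atTop,
      d2 ((Measure.pi fun _ : Fin n => empiricalLaw n fun i : Fin n => z i).map
          (uStat h (empiricalLaw n fun i : Fin n => z i) n))
        ((Measure.pi fun _ : Fin n => F).map (uStat h F n))
        ≤ (384 * (ε : ℝ≥0∞)) ^ (1 / 2 : ℝ) := by
  set Q := Measure.infinitePi fun _ : ℕ => F
  have hF2 : MemLp h 2 (Measure.pi fun _ : Fin m => F) := hpat id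
  rw [ae_iff]
  refine le_antisymm (ENNReal.le_of_forall_pos_le_add fun δ hδ _ => ?_) zero_le
  rw [zero_add]
  -- The squared `L²` error is then at most `ε * δ`, as the maximal inequality requires, and also at
  -- most `ε`, for the integral against `F`.
  have hη : ((NNReal.sqrt (ε * min δ 1) : NNReal) : ℝ≥0∞) ≠ 0 := by
    have : 0 < NNReal.sqrt (ε * min δ 1) :=
      NNReal.sqrt_pos.2 (mul_pos hε (lt_min hδ one_pos))
    exact_mod_cast this.ne'
  obtain ⟨g, hg, hgb⟩ := exists_isBlockFun_eLpNorm_le hF2 hη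
  have hgm := hgb.measurable
  obtain ⟨ι, _, _, _, b, g₀, hb, hgeq⟩ := hgb
  have hgz : ∀ z, g z = g₀ fun k => b (z k) := congrFun hgeq
  obtain ⟨C, hC⟩ := (Set.finite_range fun w => |g₀ w|).bddAbove
  have hg₀C : ∀ w, |g₀ w| ≤ C := fun w => hC ⟨w, rfl⟩
  have hdm : Measurable fun z => h z - g z := hh.sub hgm
  have hdp : ∀ τ : Fin m → Fin m,
      MemLp (fun x : Fin m → S => h (fun k => x (τ k)) - g fun k => x (τ k)) 2
        (Measure.pi fun _ => F) := fun τ =>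
    (hpat τ).sub (MemLp.of_bound (hgm.comp (by fun_prop)).aestronglyMeasurable C
      (ae_of_all _ fun x => by rw [hgz]; exact hg₀C _))
  have ha : ∫⁻ z, ‖h z - g z‖ₑ ^ 2 ∂(Measure.pi fun _ : Fin m => F)
      ≤ ((ε * min δ 1 : NNReal) : ℝ≥0∞) := by
    have h1 := eLpNorm_nnreal_pow_eq_lintegral (f := h - g)
      (μ := Measure.pi fun _ : Fin m => F) (p := 2) (by norm_num)
    simp only [ENNReal.coe_ofNat, NNReal.coe_ofNat, ENNReal.rpow_ofNat, Pi.sub_apply] at h1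
    rw [← h1]
    calc _ ≤ ((NNReal.sqrt (ε * min δ 1) : NNReal) : ℝ≥0∞) ^ 2 := by gcongr
      _ = _ := by rw [← ENNReal.coe_pow, NNReal.sq_sqrt]
  have haε : ∫⁻ z, ‖h z - g z‖ₑ ^ 2 ∂(Measure.pi fun _ : Fin m => F) ≤ ε :=
    ha.trans (by exact_mod_cast mul_le_of_le_one_right' (min_le_right _ _))
  have hbad : Q {z | ¬ ∀ᶠ n in atTop, vMean (fun x => (h x - g x) ^ 2) n z ≤ 2 * ε} ≤ δ := by
    have h1 := measure_not_eventually_vMean_le (F := F) (hdm.pow_const 2) (fun x => sq_nonneg _)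
      (fun τ => (hdp τ).integrable_sq) hε
    have hid : MemLp (fun x => h x - g x) 2 (Measure.pi fun _ : Fin m => F) := hdp id
    rw [← lintegral_enorm_sq_eq_ofReal hid] at h1
    have h2 : (ε : ℝ≥0∞) * Q {z | ¬ ∀ᶠ n in atTop, vMean (fun x => (h x - g x) ^ 2) n z ≤ 2 * ε}
        ≤ ε * δ := h1.trans (ha.trans (by exact_mod_cast mul_le_mul_right (min_le_left _ _) _))
    exact (ENNReal.mul_le_mul_iff_right (by exact_mod_cast hε.ne') ENNReal.coe_ne_top).1 h2
  refine le_trans (measure_mono_ae ?_) hbad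
  filter_upwards [ae_tendsto_sum_block (m := m) (F := F) hb (ENNReal.ofReal ((2 * C) ^ 2))
    ENNReal.ofReal_ne_top] with z hz hz_bad hz_good
  apply hz_bad
  filter_upwards [hz_good, hz.eventually_le_const (show (0 : ℝ≥0∞) < ε by exact_mod_cast hε),
    eventually_ne_atTop 0] with n hv hblk hn
  have := isProbabilityMeasure_empiricalLaw hn fun i : Fin n => z i
  refine (d2_uStat_le_of_block hm hh (memLp_pi_empiricalLaw hn _ hh) hF2 hb g₀ hg₀C n).trans ?_
  refine ENNReal.rpow_le_rpow ?_ (by norm_num)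
  simp_rw [← hgz]
  rw [lintegral_pi_empiricalLaw_eq_vMean hn z hdm]
  have hv' : ENNReal.ofReal (vMean (fun x => (h x - g x) ^ 2) n z) ≤ 2 * ε := by
    refine (ENNReal.ofReal_le_ofReal hv).trans (le_of_eq ?_)
    rw [ENNReal.ofReal_mul (by norm_num), ENNReal.ofReal_coe_nnreal, ENNReal.ofReal_ofNat]
  -- The three errors are the V-statistic, the approximation under `F`, and the mismatch of labels.
  calc _ ≤ 96 * (2 * (ε : ℝ≥0∞) + ε + ε) := by gcongr
    _ = 384 * ε := by ring

lemma ae_tendsto_d2 (hm : 2 ≤ m) {h : (Fin m → S) → ℝ} (hh : Measurable h)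
    (hpat : ∀ τ : Fin m → Fin m, MemLp (fun x : Fin m → S => h fun k => x (τ k)) 2
      (Measure.pi fun _ => F)) :
    ∀ᵐ z ∂(Measure.infinitePi fun _ : ℕ => F), Tendsto (fun n : ℕ =>
      d2 ((Measure.pi fun _ : Fin n => empiricalLaw n fun i : Fin n => z i).map
          (uStat h (empiricalLaw n fun i : Fin n => z i) n))
        ((Measure.pi fun _ : Fin n => F).map (uStat h F n))) atTop (𝓝 0) := by
  have hall : ∀ᵐ z ∂(Measure.infinitePi fun _ : ℕ => F), ∀ k : ℕ, ∀ᶠ n : ℕ in atTop,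
      d2 ((Measure.pi fun _ : Fin n => empiricalLaw n fun i : Fin n => z i).map
          (uStat h (empiricalLaw n fun i : Fin n => z i) n))
        ((Measure.pi fun _ : Fin n => F).map (uStat h F n))
        ≤ (384 * (((k + 1 : NNReal)⁻¹ : NNReal) : ℝ≥0∞)) ^ (1 / 2 : ℝ) :=
    ae_all_iff.2 fun k => ae_eventually_d2_le hm hh hpat (by positivity)
  have hlim : Tendsto (fun k : ℕ => (384 * (((k + 1 : NNReal)⁻¹ : NNReal) : ℝ≥0∞)) ^ (1 / 2 : ℝ))
      atTop (𝓝 0) := by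
    have h1 : Tendsto (fun k : ℕ => (((k + 1 : NNReal)⁻¹ : NNReal) : ℝ≥0∞)) atTop (𝓝 0) := by
      have := ENNReal.tendsto_inv_nat_nhds_zero.comp (tendsto_add_atTop_nat 1)
      refine this.congr fun k => ?_
      rw [ENNReal.coe_inv (by positivity)]
      simp
    have h2 := ENNReal.Tendsto.const_mul (a := 384) h1 (Or.inr (by norm_num))
    have h3 := (ENNReal.continuous_rpow_const (y := (1 / 2 : ℝ))).tendsto _ |>.comp h2
    simpa [Function.comp_def] using h3
  filter_upwards [hall] with z hz
  rw [ENNReal.tendsto_nhds_zero]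
  intro ε hε
  obtain ⟨k, hk⟩ := (hlim.eventually_le_const hε).exists
  filter_upwards [hz k] with n hn
  exact hn.trans hk

end Consistency

/-! ### Transfer from the canonical sequence space to the given iid sequence. -/

lemma map_sequence_eq_infinitePi {S Ω : Type*} [MeasurableSpace S] [MeasurableSpace Ω]
    {P : Measure Ω} [IsProbabilityMeasure P] {F : Measure S} {Z : ℕ → Ω → S}
    (Z_meas : ∀ i, Measurable (Z i)) (Z_indep : iIndepFun Z P) (Z_law : ∀ i, P.map (Z i) = F) :
    P.map (fun ω i => Z i ω) = Measure.infinitePi fun _ => F := by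
  rw [(iIndepFun_iff_map_fun_eq_infinitePi_map Z_meas).1 Z_indep]
  simp_rw [Z_law]

/-- For a symmetric kernel, sorted index patterns suffice in the moment condition. -/
lemma memLp_pattern {S Ω : Type*} [MeasurableSpace S] [MeasurableSpace Ω] {m : ℕ}
    {h : (Fin m → S) → ℝ} (hh : Measurable h) (h_symm : IsSymmetricKernel h)
    {P : Measure Ω} {Y : Ω → Fin m → S} {ν : Measure (Fin m → S)} (hY : MeasurePreserving Y P ν)
    (h_moment : ∀ i : Fin m → Fin m, Monotone i → MemLp (fun ω => h fun k => Y ω (i k)) 2 P)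
    (τ : Fin m → Fin m) : MemLp (fun x : Fin m → S => h fun k => x (τ k)) 2 ν := by
  have hmon := h_moment (τ ∘ Tuple.sort τ) (Tuple.monotone_sort τ)
  have hm : Measurable fun x : Fin m → S => h fun k => x (τ k) := hh.comp (by fun_prop)
  rw [← hY.map_eq, memLp_map_measure_iff hm.aestronglyMeasurable hY.measurable.aemeasurable]
  -- Sorting the pattern only permutes the arguments of `h`, which symmetry ignores.
  convert hmon using 1
  funext ω
  exact (h_symm (Tuple.sort τ) fun k => Y ω (τ k)).symm

end BootstrapU

theorem corollary5p2 {S : Type*} [MetricSpace S] [TopologicalSpace.SeparableSpace S]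
    [MeasurableSpace S] [BorelSpace S]
    {m : ℕ} (hm : 2 ≤ m) (h : (Fin m → S) → ℝ) (h_meas : Measurable h)
    (h_symm : BootstrapU.IsSymmetricKernel h)
    {Ω : Type*} [MeasurableSpace Ω] (P : Measure Ω) [IsProbabilityMeasure P]
    (F : Measure S) (hF : F ∈ BootstrapU.Gamma2h h)
    (Z : ℕ → Ω → S) (Z_meas : ∀ i, Measurable (Z i)) (Z_indep : iIndepFun Z P)
    (Z_law : ∀ i, P.map (Z i) = F)
    (h_moment : ∀ i : Fin m → Fin m, Monotone i →
      MemLp (fun ω => h (fun k => Z (i k : ℕ) ω)) 2 P) :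
    ∀ᵐ ω ∂P, Tendsto
      (fun n : ℕ =>
        BootstrapU.d2
          ((Measure.pi fun _ : Fin n =>
              BootstrapU.empiricalLaw n fun i : Fin n => Z i ω).map
            (BootstrapU.uStat h (BootstrapU.empiricalLaw n fun i : Fin n => Z i ω) n))
          (P.map fun ω' => BootstrapU.uStat h F n fun i : Fin n => Z i ω'))
      atTop (𝓝 0) := by
  have : IsProbabilityMeasure F := hF.1
  have hZ : Measurable fun ω i => Z i ω := measurable_pi_iff.2 Z_meas
  have hmap := BootstrapU.map_sequence_eq_infinitePi Z_meas Z_indep Z_law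
  have hfin : ∀ n, MeasurePreserving (fun ω (i : Fin n) => Z i ω) P (Measure.pi fun _ => F) :=
    fun n => (BootstrapU.measurePreserving_infinitePi_comp Fin.val_injective).comp ⟨hZ, hmap⟩
  have hpat := BootstrapU.memLp_pattern h_meas h_symm (hfin m) h_moment
  have hlaw : ∀ n, (P.map fun ω' => BootstrapU.uStat h F n fun i : Fin n => Z i ω')
      = (Measure.pi fun _ : Fin n => F).map (BootstrapU.uStat h F n) := fun n => by
    rw [← (hfin n).map_eq,
      Measure.map_map (BootstrapU.measurable_uStat h_meas F n) (hfin n).measurable]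
    rfl
  simp_rw [hlaw]
  have hae := BootstrapU.ae_tendsto_d2 (F := F) hm h_meas hpat
  rw [← hmap] at hae
  exact ae_of_ae_map hZ.aemeasurable hae
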